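/- Let $\mathcal X$ be a measurable space, $\mathcal Y\subseteq\mathbb R$, $\mathcal Z=\mathcal X\times\mathcal Y$, let $\mathcal H$ be a real Hilbert space and $\Psi\colon\mathcal X\to\mathcal H$ a (strongly measurable) feature map with kernel $K(x,x')=\Psi(x)\cdot\Psi(x')$, and put $r=\sqrt{\sup_x K(x,x)}$. Let $\Lambda\ge 0$, $H=\{x\mapsto \mathbf w\cdot\Psi(x):\|\mathbf w\|_{\mathcal H}\le\Lambda\}$, let $p\ge 1$ be real, and let $\mathcal F=\{(x,y)\mapsto |h(x)-y|^p : h\in H\}$. Assume that $M\ge 1$ satisfies $|h(x)-y|\le M$ for all $h\in H$ and $(x,y)\in\mathcal Z$, and let $B$ be a bound of the loss class: $|f|\le B$ for all $f\in\mathcal F$ (so $B=M$ is allowed if the losses are bounded by $M$ as well, and $B=M^p$ is always allowed). Let $T\ge 2$, let $Z_1,\dots,Z_{T+1}$, $Z_t=(X_t,Y_t)$, be an arbitrary sequence of $\mathcal Z$-valued random variables which has regular conditional distributions of $Z_t$ given $\mathbf Z_1^{t-1}=(Z_1,\dots,Z_{t-1})$ for $1\le t\le T+1$; fix versions of them, and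 let all conditional expectations below be taken with respect to these. For weights $\mathbf q=(q_1,\dots,q_T)\in\mathbb R^T$ (of any sign) let $$\mathrm{disc}(\mathbf q)=\sup_{f\in\mathcal F}\Big(\mathbb E[f(Z_{T+1})\mid\mathbf Z_1^T]-\sum_{t=1}^T q_t\,\mathbb E[f(Z_t)\mid\mathbf Z_1^{t-1}]\Big).$$ Then for every $\delta>0$, with probability at least $1-\delta$, simultaneously for all $h\in H$, $$\mathbb E\big[|h(X_{T+1})-Y_{T+1}|^p\mid\mathbf Z_1^T\big]\le\sum_{t=1}^T q_t|h(X_t)-Y_t|^p+\mathrm{disc}(\mathbf q)+C_T\Lambda r\|\mathbf q\|_2+2B\|\mathbf q\|_2\sqrt{2\log\tfrac1\delta},$$ where $C_T=48\,p\,M^p\sqrt{\pi\log T}\,\big(1+4\sqrt2\,\log^{3/2}(eT^2)\big)$ (for $\delta\geq 1$ the claim is void). For fixed $p$ and $M$, $C_T=O(\log^2T)$ as $T\to\infty$. In particular there is an absolute constant $A$ such that, for $p=2$ and every $\delta>0$, with probability at least $1-\delta$, for all $h\in H$, $$\mathbb E\big[(h(X_{T+1})-Y_{T+1})^2\mid\mathbf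 Z_1^T\big]\le\sum_{t=1}^T q_t(h(X_t)-Y_t)^2+\mathrm{disc}(\mathbf q)+A M^2(\log^2T)\,\Lambda r\|\mathbf q\|_2+2B\|\mathbf q\|_2\sqrt{2\log\tfrac1\delta}.$$ -/

import Mathlib

open MeasureTheory ProbabilityTheory Asymptotics Filter
open scoped InnerProductSpace

namespace Forecast

section Definitions

variable {𝒳 : Type*} {𝒵 : Type*} {ℋ : Type*}

/-- The reproducing kernel `K(x, x') = Ψ(x) · Ψ(x')` of a feature map `Ψ`. -/
noncomputable def kernelOf [NormedAddCommGroup ℋ] [InnerProductSpace ℝ ℋ]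
    (Ψ : 𝒳 → ℋ) (x x' : 𝒳) : ℝ :=
  ⟪Ψ x, Ψ x'⟫_ℝ

/-- The radius `r`, defined by `r ^ 2 = sup_x K(x, x)`. -/
noncomputable def kernelRadius [NormedAddCommGroup ℋ] [InnerProductSpace ℝ ℋ]
    (Ψ : 𝒳 → ℋ) : ℝ :=
  Real.sqrt (⨆ x, kernelOf Ψ x x)

/-- The hypothesis set `H = {x ↦ w · Ψ(x) : ‖w‖ ≤ Λ}`. -/
def kernelHypotheses [NormedAddCommGroup ℋ] [InnerProductSpace ℝ ℋ]
    (Ψ : 𝒳 → ℋ) (Λ : ℝ) : Set (𝒳 → ℝ) :=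
  {h | ∃ w : ℋ, ‖w‖ ≤ Λ ∧ h = fun x => ⟪w, Ψ x⟫_ℝ}

/-- The `p`-th power loss `z = (x, y) ↦ |h(x) - y| ^ p` of a hypothesis `h`, for a real exponent
`p`. For an even integer `p` this is `(h(x) - y) ^ p`. -/
noncomputable def powerLoss {𝒴 : Set ℝ} (p : ℝ) (h : 𝒳 → ℝ) (z : 𝒳 × 𝒴) : ℝ :=
  |h z.1 - (z.2 : ℝ)| ^ p

/-- The loss class `F = {z ↦ |h(x) - y| ^ p : h ∈ H}`. -/
def lossClass (𝒴 : Set ℝ) (p : ℝ) (H : Set (𝒳 → ℝ)) : Set (𝒳 × 𝒴 → ℝ) :=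
  {f | ∃ h ∈ H, f = powerLoss p h}

/-- The conditional expectation of `f` of the next observation, given that the first `t`
observations are `ζ 0, …, ζ (t - 1)`. Here `κ t` is a regular conditional distribution of the next
observation given the first `t` ones. -/
noncomputable def condMean [MeasurableSpace 𝒵] (κ : (t : ℕ) → Kernel (Fin t → 𝒵) 𝒵)
    (f : 𝒵 → ℝ) (t : ℕ) (ζ : ℕ → 𝒵) : ℝ :=
  ∫ z, f z ∂(κ t (fun i : Fin t => ζ i))

/-- The discrepancy of the weights `q` along the trajectory `ζ`:
`sup_{f ∈ F} (E[f(Z_{T+1}) | Z_1^T] - ∑_{t=1}^T q_t E[f(Z_t) | Z_1^{t-1}])`. -/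
noncomputable def disc [MeasurableSpace 𝒵] (κ : (t : ℕ) → Kernel (Fin t → 𝒵) 𝒵)
    (F : Set (𝒵 → ℝ)) {T : ℕ} (q : EuclideanSpace ℝ (Fin T)) (ζ : ℕ → 𝒵) : ℝ :=
  ⨆ f : F, (condMean κ f T ζ - ∑ t : Fin T, q t * condMean κ f t ζ)

/-- The constant `C_T = 48 p M ^ p √(π log T) (1 + 4 √2 log^{3/2}(e T ^ 2))`. -/
noncomputable def complexityConst (p M : ℝ) (T : ℕ) : ℝ :=
  48 * p * M ^ p * Real.sqrt (Real.pi * Real.log T)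
    * (1 + 4 * Real.sqrt 2 * Real.log (Real.exp 1 * (T : ℝ) ^ 2) ^ (3 / 2 : ℝ))

end Definitions

end Forecast

/-! The excess of the conditional mean over the weighted empirical loss is at most the discrepancy
plus the deviation `∑ q_t (E[f(Z_t) | past] - f(Z_t))`, so only this deviation has to be controlled
uniformly over the ball of weights. The whole argument runs with exponential moments, so that one
Chernoff bound at the end gives both the complexity term and the confidence term.

Symmetrization. Since the process is arbitrary, each conditional mean is replaced, from the last
time backwards, by an independent copy drawn from the same conditional law (Jensen), and the
exchangeable pair is randomized by a sign. The worst case over pairs at each step is a supremum over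
binary trees labelled by pairs: this is `treeValue`, and `lintegral_exp_deviation_le` is the
comparison.

Covering. On a tree the class of linear functionals has small covers made of adaptive predictors. A
learner starts from 0 and is told, before each prediction, how far to move its vector along the
current feature; as in the perceptron mistake bound, each unit of correction at scale `α` lowers the
squared distance to the target `w` by at least `α² / (2r²)`. Hence a total of `2(Λr/α)²` units
suffices, and counting the possible advice gives `exists_cover`, with log-cardinality of order
`(Λr/α)² log T`.

Chaining. A signed sum of a bounded predictor along a random path is subgaussian
(`treeMean_exp_pathSum_le`), a finite maximum raises only the mean (`SubgaussianOn.max`), and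
dependent terms are added by adding standard deviations (`SubgaussianOn.add`). With entropy of order
`1/α²` every dyadic scale contributes the same mean, so about `log T` scales cost a factor `log T`
beside the `√(log T)` of the cover, while the standard deviations form a geometric series
(`subgaussianOn_of_lipschitz`).

The passage from finite families to the whole ball uses the separable range of `Ψ` and continuity in
the weight vector. -/

namespace Forecast

/-! ### Random signed paths in binary trees and their exponential moments. -/

section Trees

variable {𝒜 : Type*}

/-- The mean of `F` over a uniformly random path through the binary tree `τ`. The path is recorded
as the list of its labels, each with the weight from `q` multiplied by the random sign. -/
noncomputable def treeMean : List ℝ → (List Bool → 𝒜) → (List (ℝ × 𝒜) → ℝ) → ℝ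
  | [], _, F => F []
  | a :: q, τ, F =>
    (treeMean q (fun b => τ (true :: b)) (fun l => F ((a, τ []) :: l))
      + treeMean q (fun b => τ (false :: b)) (fun l => F ((-a, τ []) :: l))) / 2

/-- The path `l` carries the weights `q` up to signs. -/
def HasWeights (q : List ℝ) (l : List (ℝ × 𝒜)) : Prop :=
  l.map (fun c => |c.1|) = q.map abs

theorem HasWeights.cons {q : List ℝ} {l : List (ℝ × 𝒜)} (h : HasWeights q l) {a a' : ℝ}
    (ha : |a'| = |a|) (z : 𝒜) : HasWeights (a :: q) ((a', z) :: l) := by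
  simp only [HasWeights, List.map_cons, ha] at h ⊢
  rw [h]

theorem HasWeights.length_eq {q : List ℝ} {l : List (ℝ × 𝒜)} (h : HasWeights q l) :
    l.length = q.length := by
  simpa using congrArg List.length h

theorem treeMean_mono (q : List ℝ) (τ : List Bool → 𝒜) {F G : List (ℝ × 𝒜) → ℝ}
    (h : ∀ l, HasWeights q l → F l ≤ G l) : treeMean q τ F ≤ treeMean q τ G := by
  induction q generalizing τ F G with
  | nil => exact h [] rfl
  | cons a q ih =>
    have h1 := ih (fun b => τ (true :: b)) (F := fun l => F ((a, τ []) :: l))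
      (G := fun l => G ((a, τ []) :: l)) fun l hl => h _ (hl.cons rfl _)
    have h2 := ih (fun b => τ (false :: b)) (F := fun l => F ((-a, τ []) :: l))
      (G := fun l => G ((-a, τ []) :: l)) fun l hl => h _ (hl.cons (abs_neg a) _)
    simp only [treeMean]
    linarith

theorem treeMean_const (q : List ℝ) (τ : List Bool → 𝒜) (c : ℝ) :
    treeMean q τ (fun _ => c) = c := by
  induction q generalizing τ with
  | nil => rfl
  | cons a q ih => simp [treeMean, ih]

theorem treeMean_add (q : List ℝ) (τ : List Bool → 𝒜) (F G : List (ℝ × 𝒜) → ℝ) :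
    treeMean q τ (fun l => F l + G l) = treeMean q τ F + treeMean q τ G := by
  induction q generalizing τ F G with
  | nil => rfl
  | cons a q ih => simp only [treeMean, ih]; ring

theorem treeMean_const_mul (q : List ℝ) (τ : List Bool → 𝒜) (c : ℝ) (F : List (ℝ × 𝒜) → ℝ) :
    treeMean q τ (fun l => c * F l) = c * treeMean q τ F := by
  induction q generalizing τ F with
  | nil => rfl
  | cons a q ih => simp only [treeMean, ih]; ring

theorem treeMean_sum {ι : Type*} (s : Finset ι) (q : List ℝ) (τ : List Bool → 𝒜)
    (F : ι → List (ℝ × 𝒜) → ℝ) :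
    treeMean q τ (fun l => ∑ i ∈ s, F i l) = ∑ i ∈ s, treeMean q τ (F i) := by
  classical
  induction s using Finset.induction_on with
  | empty => simp [treeMean_const]
  | insert i s hi ih => simp only [Finset.sum_insert hi, treeMean_add, ih]

theorem treeMean_pos (q : List ℝ) (τ : List Bool → 𝒜) {F : List (ℝ × 𝒜) → ℝ}
    (h : ∀ l, 0 < F l) : 0 < treeMean q τ F := by
  induction q generalizing τ F with
  | nil => exact h []
  | cons a q ih =>
    have h1 := ih (fun b => τ (true :: b)) (F := fun l => F ((a, τ []) :: l)) fun l => h _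
    have h2 := ih (fun b => τ (false :: b)) (F := fun l => F ((-a, τ []) :: l)) fun l => h _
    simp only [treeMean]
    linarith

/-- The weighted sum along a path of the values of a predictor, which sees the past labels and the
current one. -/
def pathSum : (List 𝒜 → 𝒜 → ℝ) → List (ℝ × 𝒜) → ℝ
  | _, [] => 0
  | p, c :: l => c.1 * p [] c.2 + pathSum (fun h => p (c.2 :: h)) l

/-- The predictor `p` is within `β` of `p'` along the whole sequence of labels. -/
def CloseAlong (β : ℝ) : (List 𝒜 → 𝒜 → ℝ) → (List 𝒜 → 𝒜 → ℝ) → List 𝒜 → Prop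
  | _, _, [] => True
  | p, p', z :: l =>
    |p [] z - p' [] z| ≤ β ∧ CloseAlong β (fun h => p (z :: h)) (fun h => p' (z :: h)) l

theorem CloseAlong.mono {β : ℝ} {p p' s s' : List 𝒜 → 𝒜 → ℝ} {γ : ℝ}
    (hps : ∀ h z, |p h z - p' h z| ≤ β → |s h z - s' h z| ≤ γ)
    {l : List 𝒜} (h : CloseAlong β p p' l) : CloseAlong γ s s' l := by
  induction l generalizing p p' s s' with
  | nil => trivial
  | cons z l ih => exact ⟨hps _ _ h.1, ih (fun k y => hps (z :: k) y) h.2⟩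

theorem CloseAlong.triangle {β β' : ℝ} {p p' s : List 𝒜 → 𝒜 → ℝ} {l : List 𝒜}
    (h : CloseAlong β p s l) (h' : CloseAlong β' p' s l) : CloseAlong (β + β') p p' l := by
  induction l generalizing p p' s with
  | nil => trivial
  | cons z l ih =>
    refine ⟨?_, ih h.2 h'.2⟩
    have h1 := abs_sub_le (p [] z) (s [] z) (p' [] z)
    rw [abs_sub_comm (s [] z)] at h1
    exact h1.trans (add_le_add h.1 h'.1)

theorem pathSum_sub (p p' : List 𝒜 → 𝒜 → ℝ) (l : List (ℝ × 𝒜)) :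
    pathSum (fun h z => p h z - p' h z) l = pathSum p l - pathSum p' l := by
  induction l generalizing p p' with
  | nil => simp [pathSum]
  | cons c l ih => simp only [pathSum, ih]; ring

theorem pathSum_neg (p : List 𝒜 → 𝒜 → ℝ) (l : List (ℝ × 𝒜)) :
    pathSum (fun h z => -p h z) l = -pathSum p l := by
  induction l generalizing p with
  | nil => simp [pathSum]
  | cons c l ih => simp only [pathSum, ih]; ring

/-- Two predictors may be close on one path only, whereas the subgaussian bound needs a difference
bounded on all paths. Clamping provides the global bound and is invisible on the path in question.
-/
theorem CloseAlong.pathSum_eq_clamp {β : ℝ} {p p' : List 𝒜 → 𝒜 → ℝ} {l : List (ℝ × 𝒜)}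
    (h : CloseAlong β p p' (l.map Prod.snd)) :
    pathSum (fun h z => max (-β) (min β (p h z - p' h z))) l = pathSum p l - pathSum p' l := by
  induction l generalizing p p' with
  | nil => simp [pathSum]
  | cons c l ih =>
    have h1 := abs_le.1 h.1
    simp only [pathSum]
    rw [ih h.2, min_eq_right h1.2, max_eq_right h1.1]
    ring

theorem CloseAlong.pathSum_sub_le {β : ℝ} {p p' : List 𝒜 → 𝒜 → ℝ} {q : List ℝ}
    {l : List (ℝ × 𝒜)} (hq : HasWeights q l) (h : CloseAlong β p p' (l.map Prod.snd)) :
    pathSum p l - pathSum p' l ≤ β * (q.map abs).sum := by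
  rw [← hq]
  clear hq
  induction l generalizing p p' with
  | nil => simp [pathSum]
  | cons c l ih =>
    have h1 := ih h.2
    have h2 : c.1 * (p [] c.2 - p' [] c.2) ≤ |c.1| * β :=
      (le_abs_self _).trans (by rw [abs_mul]; exact mul_le_mul_of_nonneg_left h.1 (abs_nonneg _))
    simp only [pathSum, List.map_cons, List.sum_cons]
    linarith

/-- Hoeffding's argument on a tree. The value at the root is fixed before its sign is drawn, so
averaging over that sign gives a `cosh`. The two subtrees differ, but the inductive bound does not
depend on the tree. -/
theorem treeMean_exp_pathSum_le {c : ℝ} {p : List 𝒜 → 𝒜 → ℝ} (hp : ∀ h z, |p h z| ≤ c)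
    (q : List ℝ) (τ : List Bool → 𝒜) (t : ℝ) :
    treeMean q τ (fun l => Real.exp (t * pathSum p l))
      ≤ Real.exp (t ^ 2 * c ^ 2 * (q.map (· ^ 2)).sum / 2) := by
  induction q generalizing τ p with
  | nil => simp [treeMean, pathSum]
  | cons a q ih =>
    have h1 := ih (p := fun h => p (τ [] :: h)) (fun h z => hp _ _) (fun b => τ (true :: b))
    have h2 := ih (p := fun h => p (τ [] :: h)) (fun h z => hp _ _) (fun b => τ (false :: b))
    simp only [treeMean, pathSum, mul_add, Real.exp_add, treeMean_const_mul, List.map_cons,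
      List.sum_cons]
    set E := Real.exp (t ^ 2 * c ^ 2 * (q.map (· ^ 2)).sum / 2)
    set x := t * (a * p [] (τ [])) with hx
    have hx' : t * (-a * p [] (τ [])) = -x := by rw [hx]; ring
    have hc := Real.cosh_le_exp_half_sq x
    rw [Real.cosh_eq] at hc
    have hxx : x ^ 2 ≤ t ^ 2 * c ^ 2 * a ^ 2 := by
      have : p [] (τ []) ^ 2 ≤ c ^ 2 := sq_le_sq' (abs_le.1 (hp _ _)).1 (abs_le.1 (hp _ _)).2
      calc x ^ 2 = t ^ 2 * a ^ 2 * p [] (τ []) ^ 2 := by rw [hx]; ring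
        _ ≤ t ^ 2 * a ^ 2 * c ^ 2 := by gcongr
        _ = _ := by ring
    have hE : 0 < E := Real.exp_pos _
    rw [hx']
    calc _ ≤ (Real.exp x * E + Real.exp (-x) * E) / 2 := by gcongr
      _ = (Real.exp x + Real.exp (-x)) / 2 * E := by ring
      _ ≤ Real.exp (t ^ 2 * c ^ 2 * a ^ 2 / 2) * E := by
        refine mul_le_mul_of_nonneg_right (hc.trans (Real.exp_le_exp.2 ?_)) hE.le
        linarith
      _ = Real.exp _ := by rw [← Real.exp_add]; congr 1; ring

/-- `X` has, on the random path, the exponential moments of a variable with mean at most `m` and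
variance proxy `σ ^ 2`. -/
def SubgaussianOn (q : List ℝ) (τ : List Bool → 𝒜) (X : List (ℝ × 𝒜) → ℝ) (m σ : ℝ) : Prop :=
  ∀ t : ℝ, 0 ≤ t → treeMean q τ (fun l => Real.exp (t * X l)) ≤ Real.exp (t * m + t ^ 2 * σ ^ 2 / 2)

variable {q : List ℝ} {τ : List Bool → 𝒜}

theorem SubgaussianOn.of_le {X Y : List (ℝ × 𝒜) → ℝ} {m σ c m' σ' : ℝ}
    (h : SubgaussianOn q τ X m σ) (hY : ∀ l, HasWeights q l → Y l ≤ X l + c)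
    (hm : m + c ≤ m') (hσ : |σ| ≤ σ') : SubgaussianOn q τ Y m' σ' := fun t ht => by
  have hs : σ ^ 2 ≤ σ' ^ 2 := by rw [← sq_abs σ]; gcongr
  calc _ ≤ treeMean q τ (fun l => Real.exp (t * c) * Real.exp (t * X l)) := by
        refine treeMean_mono q τ fun l hl => ?_
        rw [← Real.exp_add, ← mul_add]
        gcongr
        linarith [hY l hl]
    _ ≤ Real.exp (t * c) * Real.exp (t * m + t ^ 2 * σ ^ 2 / 2) := by
        rw [treeMean_const_mul]
        exact mul_le_mul_of_nonneg_left (h t ht) (Real.exp_pos _).le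
    _ ≤ _ := by
        rw [← Real.exp_add, Real.exp_le_exp]
        have h1 := mul_le_mul_of_nonneg_left hm ht
        have h2 := mul_le_mul_of_nonneg_left hs (sq_nonneg t)
        linarith

/-- Hölder's inequality with conjugate exponents `(σ + σ') / σ` and `(σ + σ') / σ'`, obtained from
convexity of `exp` after normalizing both moments. No independence is available, so standard
deviations add instead of variances. -/
theorem SubgaussianOn.add {X X' : List (ℝ × 𝒜) → ℝ} {m m' σ σ' : ℝ}
    (h : SubgaussianOn q τ X m σ) (h' : SubgaussianOn q τ X' m' σ') (hσ : 0 < σ) (hσ' : 0 < σ') :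
    SubgaussianOn q τ (fun l => X l + X' l) (m + m') (σ + σ') := fun t ht => by
  set θ := σ / (σ + σ') with hθ
  set θ' := σ' / (σ + σ') with hθ'
  have hs : 0 < σ + σ' := by positivity
  have hθ0 : 0 < θ := by positivity
  have hθ0' : 0 < θ' := by positivity
  have hsum : θ + θ' = 1 := by rw [hθ, hθ', ← add_div, div_self hs.ne']
  set u := t / θ * m + (t / θ) ^ 2 * σ ^ 2 / 2 with hu
  set u' := t / θ' * m' + (t / θ') ^ 2 * σ' ^ 2 / 2 with hu'
  have key : θ * u + θ' * u' = t * (m + m') + t ^ 2 * (σ + σ') ^ 2 / 2 := by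
    rw [hu, hu', hθ, hθ']
    field_simp
    ring
  clear_value u u'
  have h1 : treeMean q τ (fun l => Real.exp (-u) * Real.exp (t / θ * X l)) ≤ 1 := by
    have hm := h (t / θ) (by positivity)
    rw [← hu] at hm
    rw [treeMean_const_mul]
    calc _ ≤ Real.exp (-u) * Real.exp u :=
          mul_le_mul_of_nonneg_left hm (Real.exp_pos _).le
      _ = 1 := by rw [← Real.exp_add]; simp
  have h2 : treeMean q τ (fun l => Real.exp (-u') * Real.exp (t / θ' * X' l)) ≤ 1 := by
    have hm := h' (t / θ') (by positivity)
    rw [← hu'] at hm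
    rw [treeMean_const_mul]
    calc _ ≤ Real.exp (-u') * Real.exp u' :=
          mul_le_mul_of_nonneg_left hm (Real.exp_pos _).le
      _ = 1 := by rw [← Real.exp_add]; simp
  rw [← key]
  calc _ ≤ treeMean q τ (fun l => Real.exp (θ * u + θ' * u') *
          (θ * (Real.exp (-u) * Real.exp (t / θ * X l))
            + θ' * (Real.exp (-u') * Real.exp (t / θ' * X' l)))) := by
        refine treeMean_mono q τ fun l _ => ?_
        have hc := convexOn_exp.2 (Set.mem_univ (-u + t / θ * X l))
          (Set.mem_univ (-u' + t / θ' * X' l)) hθ0.le hθ0'.le hsum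
        simp only [smul_eq_mul] at hc
        rw [← Real.exp_add, ← Real.exp_add]
        refine le_trans ?_ (mul_le_mul_of_nonneg_left hc (Real.exp_pos _).le)
        rw [← Real.exp_add]
        refine (congrArg Real.exp ?_).le
        have e1 : θ * (t / θ * X l) = t * X l := by field_simp
        have e2 : θ' * (t / θ' * X' l) = t * X' l := by field_simp
        linear_combination -e1 - e2
    _ ≤ Real.exp (θ * u + θ' * u') * 1 := by
        rw [treeMean_const_mul, treeMean_add, treeMean_const_mul q τ θ, treeMean_const_mul q τ θ']
        refine mul_le_mul_of_nonneg_left ?_ (Real.exp_pos _).le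
        rw [← hsum]
        exact add_le_add (mul_le_of_le_one_right hθ0.le h1) (mul_le_of_le_one_right hθ0'.le h2)
    _ = _ := mul_one _

theorem SubgaussianOn.sum_range {X : ℕ → List (ℝ × 𝒜) → ℝ} {m σ : ℕ → ℝ}
    (h : ∀ k, SubgaussianOn q τ (X k) (m k) (σ k)) (hσ : ∀ k, 0 < σ k) (n : ℕ) :
    SubgaussianOn q τ (fun l => ∑ k ∈ Finset.range (n + 1), X k l)
      (∑ k ∈ Finset.range (n + 1), m k) (∑ k ∈ Finset.range (n + 1), σ k) := by
  induction n with
  | zero => simpa using h 0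
  | succ n ih =>
    have := ih.add (h (n + 1)) (Finset.sum_pos (fun k _ => hσ k) (by simp)) (hσ _)
    simpa only [Finset.sum_range_succ _ (n + 1)] using this

/-- Monotonicity of power means, from convexity of `exp` between `s * X l - C` and `0`. -/
theorem treeMean_rpow_le {X : List (ℝ × 𝒜) → ℝ} {s t : ℝ} (ht : 0 ≤ t) (hs : 0 < s) (hts : t ≤ s)
    {C : ℝ} (h : treeMean q τ (fun l => Real.exp (s * X l)) ≤ Real.exp C) :
    treeMean q τ (fun l => Real.exp (t * X l)) ≤ Real.exp (t / s * C) := by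
  set θ := t / s with hθ
  have hθ0 : 0 ≤ θ := by positivity
  have hθ1 : θ ≤ 1 := (div_le_one hs).2 hts
  have h1 : treeMean q τ (fun l => Real.exp (-C) * Real.exp (s * X l)) ≤ 1 := by
    rw [treeMean_const_mul]
    calc _ ≤ Real.exp (-C) * Real.exp C := mul_le_mul_of_nonneg_left h (Real.exp_pos _).le
      _ = 1 := by rw [← Real.exp_add]; simp
  calc _ ≤ treeMean q τ (fun l => Real.exp (θ * C) *
          (θ * (Real.exp (-C) * Real.exp (s * X l)) + (1 - θ))) := by
        refine treeMean_mono q τ fun l _ => ?_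
        have hc := convexOn_exp.2 (Set.mem_univ (-C + s * X l))
          (Set.mem_univ 0) hθ0 (sub_nonneg.2 hθ1) (by ring)
        simp only [smul_eq_mul, mul_zero, add_zero, Real.exp_zero, mul_one] at hc
        rw [← Real.exp_add]
        refine le_trans ?_ (mul_le_mul_of_nonneg_left hc (Real.exp_pos _).le)
        rw [← Real.exp_add]
        refine (congrArg Real.exp ?_).le
        have e1 : θ * (s * X l) = t * X l := by rw [hθ]; field_simp
        rw [mul_add θ, e1]
        ring
    _ ≤ Real.exp (θ * C) * 1 := by
        rw [treeMean_const_mul, treeMean_add, treeMean_const_mul q τ θ, treeMean_const]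
        refine mul_le_mul_of_nonneg_left ?_ (Real.exp_pos _).le
        nlinarith [mul_le_mul_of_nonneg_left h1 hθ0]
    _ = _ := mul_one _

/-- The maximal inequality: the maximum of at most `N` centred subgaussian variables. -/
theorem SubgaussianOn.max {E : Type*} [Fintype E] {X : E → List (ℝ × 𝒜) → ℝ}
    {Y : List (ℝ × 𝒜) → ℝ} {σ Λ : ℝ} (hσ : 0 < σ) (h : ∀ e, SubgaussianOn q τ (X e) 0 σ)
    (hY : ∀ l, HasWeights q l → ∃ e, Y l ≤ X e l) (hΛ : 0 ≤ Λ)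
    (hN : (Fintype.card E : ℝ) ≤ Real.exp Λ) :
    SubgaussianOn q τ Y (σ * Real.sqrt (2 * Λ)) σ := by
  have union : ∀ t : ℝ, 0 ≤ t →
      treeMean q τ (fun l => Real.exp (t * Y l)) ≤ Real.exp (Λ + t ^ 2 * σ ^ 2 / 2) := by
    intro t ht
    calc _ ≤ treeMean q τ (fun l => ∑ e, Real.exp (t * X e l)) := by
          refine treeMean_mono q τ fun l hl => ?_
          obtain ⟨e, he⟩ := hY l hl
          refine le_trans (Real.exp_le_exp.2 (mul_le_mul_of_nonneg_left he ht)) ?_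
          exact Finset.single_le_sum (f := fun e => Real.exp (t * X e l))
            (fun e _ => (Real.exp_pos _).le) (Finset.mem_univ e)
      _ ≤ ∑ _e : E, Real.exp (t ^ 2 * σ ^ 2 / 2) := by
          rw [treeMean_sum]
          refine Finset.sum_le_sum fun e _ => ?_
          simpa using h e t ht
      _ ≤ Real.exp Λ * Real.exp (t ^ 2 * σ ^ 2 / 2) := by
          rw [Finset.sum_const, nsmul_eq_mul, Finset.card_univ]
          gcongr
      _ = _ := by rw [Real.exp_add]
  have hsq : Real.sqrt (2 * Λ) ^ 2 = 2 * Λ := Real.sq_sqrt (by positivity)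
  set w := Real.sqrt (2 * Λ) with hw
  have hw0 : 0 ≤ w := Real.sqrt_nonneg _
  intro t ht
  -- The union bound costs `Λ = w² / 2`. For `t ≥ w / σ` this is absorbed by `t * σ * w`. For
  -- smaller `t` the union bound is used at `w / σ`, where its exponent is `w²`, and interpolation
  -- down to `t` gives exactly `t * σ * w`. In this way the variance proxy is not enlarged.
  by_cases hcase : w / σ ≤ t
  · refine (union t ht).trans (Real.exp_le_exp.2 ?_)
    have : w ≤ t * σ := (div_le_iff₀ hσ).1 hcase
    nlinarith
  · push Not at hcase
    have hpos : 0 < w / σ := ht.trans_lt hcase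
    refine (treeMean_rpow_le ht hpos hcase.le (union _ hpos.le)).trans (Real.exp_le_exp.2 ?_)
    have hwp : 0 < w := by
      rcases hw0.eq_or_lt with h0 | h0
      · rw [← h0] at hpos; simp at hpos
      · exact h0
    have e : t / (w / σ) * (Λ + (w / σ) ^ 2 * σ ^ 2 / 2) = t * (σ * w) := by
      have : Λ = w ^ 2 / 2 := by linarith
      rw [this]
      field_simp
      ring
    rw [e]
    have : 0 ≤ t ^ 2 * σ ^ 2 / 2 := by positivity
    linarith

theorem subgaussianOn_pathSum {c ν : ℝ} {p : List 𝒜 → 𝒜 → ℝ} (hp : ∀ h z, |p h z| ≤ c)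
    (hν : (q.map (· ^ 2)).sum = ν ^ 2) : SubgaussianOn q τ (pathSum p) 0 (c * ν) := fun t _ => by
  refine (treeMean_exp_pathSum_le hp q τ t).trans (Real.exp_le_exp.2 (le_of_eq ?_))
  rw [hν]
  ring

end Trees

/-! ### Sequential covers of a ball of linear functionals by predictors with advice. -/

section Advice

variable {𝒜 ℋ : Type*} [NormedAddCommGroup ℋ] [InnerProductSpace ℝ ℋ]

/-- Move `v` along `ξ` so that its inner product with `ξ` grows by `k * α`. -/
noncomputable def nudge (α : ℝ) (v ξ : ℋ) (k : ℤ) : ℋ := v + (k * α / ‖ξ‖ ^ 2) • ξ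

/-- The predictor that follows a linear functional of the feature map `x`, nudged before each
prediction as prescribed by the advice. -/
noncomputable def track (α : ℝ) (x : 𝒜 → ℋ) : ℋ → (ℕ → ℤ) → List 𝒜 → 𝒜 → ℝ
  | v, j, [], z => ⟪nudge α v (x z) (j 0), x z⟫_ℝ
  | v, j, y :: h, z => track α x (nudge α v (x y) (j 0)) (fun n => j (n + 1)) h z

/-- The perceptron potential argument for one prediction: if the error exceeds `α`, moving along `ξ`
by the error rounded to a multiple of `α` makes the prediction accurate and brings the vector closer
to `w`, by an amount proportional to the number of units spent. -/
theorem exists_nudge {α r : ℝ} (hα : 0 < α) (v w ξ : ℋ) (hξ : ‖ξ‖ ≤ r) :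
    ∃ k : ℤ, |⟪nudge α v ξ k, ξ⟫_ℝ - ⟪w, ξ⟫_ℝ| ≤ α ∧
      ‖w - nudge α v ξ k‖ ^ 2 + |(k : ℝ)| * (α ^ 2 / (2 * r ^ 2)) ≤ ‖w - v‖ ^ 2 := by
  set d := ⟪w - v, ξ⟫_ℝ with hd
  have hd' : d = ⟪w, ξ⟫_ℝ - ⟪v, ξ⟫_ℝ := inner_sub_left _ _ _
  by_cases hsmall : |d| ≤ α
  · refine ⟨0, ?_, ?_⟩
    · rw [abs_sub_comm]
      simpa [nudge, ← hd'] using hsmall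
    · simp [nudge]
  push Not at hsmall
  have hξ0 : ξ ≠ 0 := by
    rintro rfl
    simp only [hd, inner_zero_right, abs_zero] at hsmall
    linarith
  have hn : 0 < ‖ξ‖ := norm_pos_iff.2 hξ0
  have hr : 0 < r := hn.trans_le hξ
  set δ := d / α with hδ
  have hdδ : d = δ * α := by rw [hδ]; field_simp
  have hδ1 : 1 < |δ| := by rw [hδ, abs_div, abs_of_pos hα, one_lt_div hα]; exact hsmall
  have hround := abs_le.1 (abs_sub_round δ)
  set k := round δ with hk
  have hin : ⟪nudge α v ξ k, ξ⟫_ℝ = ⟪v, ξ⟫_ℝ + k * α := by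
    rw [nudge, inner_add_left, inner_smul_left, real_inner_self_eq_norm_sq]
    simp only [conj_trivial]
    field_simp
  refine ⟨k, ?_, ?_⟩
  · rw [hin, abs_le]
    constructor <;> nlinarith
  have hnorm : ‖w - nudge α v ξ k‖ ^ 2
      = ‖w - v‖ ^ 2 - (2 * k * δ - (k : ℝ) ^ 2) * (α ^ 2 / ‖ξ‖ ^ 2) := by
    rw [nudge, ← sub_sub, norm_sub_sq_real, inner_smul_right, ← hd, norm_smul, mul_pow,
      Real.norm_eq_abs, sq_abs, hdδ]
    field_simp
    ring
  -- For `|k| ≥ 2` the rounding error of at most `1/2` is harmless. For `|k| = 1` rounding alone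
  -- would give only `0`; here `|δ| > 1` is needed, which is why errors up to `α` are left
  -- uncorrected.
  have hkey : |(k : ℝ)| / 2 ≤ 2 * k * δ - (k : ℝ) ^ 2 := by
    rcases lt_trichotomy k 0 with h0 | h0 | h0
    · have h1 : (k : ℝ) ≤ -1 := by exact_mod_cast Int.le_sub_one_of_lt h0
      have hδn : δ < -1 := by
        rcases lt_abs.1 hδ1 with h | h <;> linarith
      rw [abs_of_neg (by linarith)]
      by_cases h2 : k = -1
      · rw [h2]; push_cast; linarith
      · have h3 : (k : ℝ) ≤ -2 := by exact_mod_cast (show k ≤ -2 by lia)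
        nlinarith
    · rw [h0] at hround
      simp only [Int.cast_zero, sub_zero] at hround
      rcases lt_abs.1 hδ1 with h | h <;> linarith
    · have h1 : (1 : ℝ) ≤ k := by exact_mod_cast h0
      have hδn : 1 < δ := by
        rcases lt_abs.1 hδ1 with h | h <;> linarith
      rw [abs_of_pos (by linarith)]
      by_cases h2 : k = 1
      · rw [h2]; push_cast; linarith
      · have h3 : (2 : ℝ) ≤ k := by exact_mod_cast (show 2 ≤ k by lia)
        nlinarith
  have hle : α ^ 2 / r ^ 2 ≤ α ^ 2 / ‖ξ‖ ^ 2 := by gcongr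
  have h1 : |(k : ℝ)| * (α ^ 2 / (2 * r ^ 2)) = |(k : ℝ)| / 2 * (α ^ 2 / r ^ 2) := by
    field_simp
  have h2 : |(k : ℝ)| / 2 * (α ^ 2 / r ^ 2)
      ≤ (2 * k * δ - (k : ℝ) ^ 2) * (α ^ 2 / ‖ξ‖ ^ 2) :=
    mul_le_mul hkey hle (by positivity) (le_trans (by positivity) hkey)
  rw [hnorm, h1]
  linarith

/-- The decrease of the squared distance to `w` telescopes along the path, so the total advice is
paid for by the initial distance, whatever the labels are. -/
theorem exists_advice {α r : ℝ} (hα : 0 < α) {x : 𝒜 → ℋ} (hx : ∀ z, ‖x z‖ ≤ r) (w : ℋ)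
    (l : List 𝒜) (v : ℋ) :
    ∃ j : ℕ → ℤ, (∀ i, l.length ≤ i → j i = 0) ∧
      (∑ i ∈ Finset.range l.length, |(j i : ℝ)|) * (α ^ 2 / (2 * r ^ 2)) ≤ ‖w - v‖ ^ 2 ∧
      CloseAlong α (track α x v j) (fun _ z => ⟪w, x z⟫_ℝ) l := by
  induction l generalizing v with
  | nil => exact ⟨0, by simp, by simp, trivial⟩
  | cons z l ih =>
    obtain ⟨k, hk, hk'⟩ := exists_nudge hα v w (x z) (hx z)
    obtain ⟨j, hj, hj', hc⟩ := ih (nudge α v (x z) k)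
    refine ⟨fun i => Nat.casesOn i k j, ?_, ?_, ?_, ?_⟩
    · rintro (_ | i) hi
      · simp at hi
      · exact hj i (by simpa using hi)
    · rw [List.length_cons, Finset.sum_range_succ', add_mul]
      exact (add_le_add_left hj' _).trans hk'
    · exact hk
    · exact hc

/-- The advice sequences that change one entry by one before time `T`, or none. -/
noncomputable def unitAdvice (T : ℕ) : Finset (ℕ → ℤ) := by
  classical
  exact insert 0 ((Finset.range T ×ˢ {1, -1}).image fun c => Pi.single c.1 c.2)

/-- The sums of `K` unit advice sequences. -/
noncomputable def adviceSet (T : ℕ) : ℕ → Finset (ℕ → ℤ)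
  | 0 => {0}
  | K + 1 => by
    classical
    exact (adviceSet T K ×ˢ unitAdvice T).image fun c => c.1 + c.2

theorem card_unitAdvice_le (T : ℕ) : (unitAdvice T).card ≤ 2 * T + 1 := by
  classical
  refine (Finset.card_insert_le _ _).trans (Nat.add_le_add_right ?_ 1)
  refine Finset.card_image_le.trans ?_
  rw [Finset.card_product, Finset.card_range, mul_comm]
  exact Nat.mul_le_mul_right _ (Finset.card_le_two)

theorem card_adviceSet_le (T K : ℕ) : (adviceSet T K).card ≤ (2 * T + 1) ^ K := by
  classical
  induction K with
  | zero => simp [adviceSet]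
  | succ K ih =>
    refine Finset.card_image_le.trans ?_
    rw [Finset.card_product, pow_succ]
    exact Nat.mul_le_mul ih (card_unitAdvice_le T)

/-- Induction on the budget: one unit, with the sign of a nonzero entry, is split off. The zero
sequence among the unit advice handles budgets that are not exhausted. -/
theorem mem_adviceSet {T K : ℕ} {j : ℕ → ℤ} (hj : ∀ i, T ≤ i → j i = 0)
    (hK : ∑ i ∈ Finset.range T, (j i).natAbs ≤ K) : j ∈ adviceSet T K := by
  classical
  induction K generalizing j with
  | zero =>
    have h0 : ∀ i, j i = 0 := fun i => by
      rcases lt_or_ge i T with hi | hi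
      · have := Finset.sum_eq_zero_iff.1 (Nat.le_zero.1 hK) i (Finset.mem_range.2 hi)
        simpa using this
      · exact hj i hi
    simp [adviceSet, funext h0, Pi.zero_def]
  | succ K ih =>
    have hsucc : ∀ a ∈ adviceSet T K, ∀ b ∈ unitAdvice T, a + b ∈ adviceSet T (K + 1) :=
      fun a ha b hb => Finset.mem_image.2 ⟨(a, b), Finset.mem_product.2 ⟨ha, hb⟩, rfl⟩
    by_cases hle : ∑ i ∈ Finset.range T, (j i).natAbs ≤ K
    · simpa using hsucc j (ih hj hle) 0 (Finset.mem_insert_self _ _)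
    obtain ⟨t, ht, hjt⟩ : ∃ t ∈ Finset.range T, (j t).natAbs ≠ 0 := by
      by_contra! h
      exact hle (by rw [Finset.sum_eq_zero h]; exact Nat.zero_le _)
    set s : ℤ := (j t).sign with hs
    have hs' : s = 1 ∨ s = -1 := by
      rcases lt_trichotomy (j t) 0 with h | h | h
      · exact Or.inr (Int.sign_eq_neg_one_of_neg h)
      · simp [h] at hjt
      · exact Or.inl (Int.sign_eq_one_of_pos h)
    have hmem : (Pi.single t s : ℕ → ℤ) ∈ unitAdvice T :=
      Finset.mem_insert_of_mem (Finset.mem_image.2 ⟨(t, s), by simpa [hs'] using ht, rfl⟩)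
    have := hsucc (j - Pi.single t s) (ih ?_ ?_) _ hmem
    · simpa using this
    · intro i hi
      have hit : i ≠ t := by rintro rfl; simp at ht; lia
      simp [hit, hj i hi]
    · rw [← Finset.add_sum_erase _ _ ht] at hK ⊢
      have h1 : ∑ i ∈ (Finset.range T).erase t, ((j - Pi.single t s : ℕ → ℤ) i).natAbs
          = ∑ i ∈ (Finset.range T).erase t, (j i).natAbs :=
        Finset.sum_congr rfl fun i hi => by simp [Finset.ne_of_mem_erase hi]
      have h2 : ((j - Pi.single t s : ℕ → ℤ) t).natAbs + 1 = (j t).natAbs := by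
        simp only [Pi.sub_apply, Pi.single_eq_same]
        rcases lt_trichotomy (j t) 0 with h | h | h
        · rw [hs, Int.sign_eq_neg_one_of_neg h]; lia
        · simp [h] at hjt
        · rw [hs, Int.sign_eq_one_of_pos h]; lia
      lia

theorem adviceSet_nonempty (T K : ℕ) : (adviceSet T K).Nonempty :=
  ⟨0, mem_adviceSet (fun _ _ => rfl) (by simp)⟩

/-- The budget is `2(Λr/α)²` units, each chosen in at most `2T + 1` ways. The finite set is fixed in
advance; only the choice of its member depends on `w` and on the path. -/
theorem exists_cover {α r Λ : ℝ} (hα : 0 < α) (hr : 0 < r) {x : 𝒜 → ℋ}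
    (hx : ∀ z, ‖x z‖ ≤ r) (T : ℕ) :
    ∃ A : Finset (ℕ → ℤ), A.Nonempty ∧
      (A.card : ℝ) ≤ Real.exp (2 * (Λ * r / α) ^ 2 * Real.log (2 * T + 1)) ∧
      ∀ w : ℋ, ‖w‖ ≤ Λ → ∀ l : List 𝒜, l.length = T →
        ∃ j ∈ A, CloseAlong α (track α x 0 j) (fun _ z => ⟪w, x z⟫_ℝ) l := by
  set c := 2 * (Λ * r / α) ^ 2 with hc
  have hc0 : 0 ≤ c := by positivity
  have hT : (1 : ℝ) ≤ 2 * T + 1 := by linarith [Nat.cast_nonneg (α := ℝ) T]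
  refine ⟨adviceSet T ⌊c⌋₊, adviceSet_nonempty _ _, ?_, fun w hw l hl => ?_⟩
  · calc ((adviceSet T ⌊c⌋₊).card : ℝ) ≤ (2 * T + 1) ^ ⌊c⌋₊ := by
          exact_mod_cast card_adviceSet_le T ⌊c⌋₊
      _ = Real.exp (⌊c⌋₊ * Real.log (2 * T + 1)) := by
          rw [Real.exp_nat_mul, Real.exp_log (by linarith)]
      _ ≤ _ := by
          refine Real.exp_le_exp.2 (mul_le_mul_of_nonneg_right (Nat.floor_le hc0) ?_)
          exact Real.log_nonneg hT
  · obtain ⟨j, hj, hj', hcl⟩ := exists_advice hα hx w l 0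
    rw [hl] at hj hj'
    refine ⟨j, mem_adviceSet hj (Nat.le_floor ?_), hcl⟩
    have h1 : (∑ i ∈ Finset.range T, |(j i : ℝ)|) * (α ^ 2 / (2 * r ^ 2)) ≤ Λ ^ 2 := by
      refine hj'.trans ?_
      rw [sub_zero]
      gcongr
    have h2 : ((∑ i ∈ Finset.range T, (j i).natAbs : ℕ) : ℝ)
        = ∑ i ∈ Finset.range T, |(j i : ℝ)| := by
      push_cast
      exact Finset.sum_congr rfl fun i _ => by rw [Nat.cast_natAbs, Int.cast_abs]
    rw [h2, hc]
    rw [← mul_div_assoc, div_le_iff₀ (by positivity)] at h1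
    have h3 : 2 * (Λ * r / α) ^ 2 = Λ ^ 2 * (2 * r ^ 2) / α ^ 2 := by field_simp
    rw [h3, le_div_iff₀ (by positivity)]
    exact h1

end Advice

/-! ### Dyadic chaining for Lipschitz functions of linear functionals. -/

section Chaining

variable {𝒜 : Type*} {q : List ℝ} {τ : List Bool → 𝒜}

theorem abs_clamp_le {c : ℝ} (hc : 0 ≤ c) (u : ℝ) : |max (-c) (min c u)| ≤ c :=
  abs_le.2 ⟨le_max_left _ _, max_le (by linarith) (min_le_left _ _)⟩

theorem abs_clamp_sub_le {c u v : ℝ} (hv : |v| ≤ c) : |max (-c) (min c u) - v| ≤ |u - v| := by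
  have h := abs_le.1 hv
  have e : max (-c) (min c u) - v = max (-c) (min c u) - max (-c) (min c v) := by
    rw [min_eq_right h.2, max_eq_right h.1]
  rw [e]
  refine (abs_max_sub_max_le_max _ _ _ _).trans (max_le (by simp) ?_)
  exact (abs_min_sub_min_le_max c u c v).trans (by simp)

/-- The maximum of the weighted sums of a finite family of bounded predictors. -/
theorem subgaussianOn_iSup_pathSum {E : Type*} [Fintype E] [Nonempty E] {c ν C : ℝ} (hc : 0 < c)
    (hν : 0 < ν) (hq : (q.map (· ^ 2)).sum = ν ^ 2) {P : E → List 𝒜 → 𝒜 → ℝ}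
    (hP : ∀ e h z, |P e h z| ≤ c) (hC : 0 ≤ C) (hE : (Fintype.card E : ℝ) ≤ Real.exp C) :
    SubgaussianOn q τ (fun l => ⨆ e, pathSum (P e) l) (c * ν * Real.sqrt (2 * C)) (c * ν) := by
  refine SubgaussianOn.max (mul_pos hc hν) (fun e => subgaussianOn_pathSum (hP e) hq)
    (fun l _ => ?_) hC hE
  obtain ⟨e, he⟩ := exists_eq_ciSup_of_finite (f := fun e => pathSum (P e) l)
  exact ⟨e, he.ge⟩

/-- Chaining along covers at the scales `β / 2 ^ k`. -/
theorem subgaussianOn_of_covers {ι : Type*} {g : ι → 𝒜 → ℝ} {b β ν D m₀ : ℝ} {C : ℕ → ℝ}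
    (hb : 0 < b) (hβ : 0 < β) (hν : 0 < ν) (hD : 0 ≤ D)
    (hq : (q.map (· ^ 2)).sum = ν ^ 2) {E : ℕ → Type*} [∀ k, Fintype (E k)] [∀ k, Nonempty (E k)]
    (P : (k : ℕ) → E k → List 𝒜 → 𝒜 → ℝ) (hP : ∀ k e h z, |P k e h z| ≤ b)
    (hE : ∀ k, (Fintype.card (E k) : ℝ) ≤ Real.exp (C k)) (hC0 : ∀ k, 0 ≤ C k)
    (hC : ∀ k, C k ≤ (D / (β / 2 ^ k)) ^ 2) (hm₀ : b * Real.sqrt (2 * C 0) ≤ m₀)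
    (hcover : ∀ l, HasWeights q l → ∀ i k, ∃ e,
      CloseAlong (β / 2 ^ k) (P k e) (fun _ z => g i z) (l.map Prod.snd))
    {Y : List (ℝ × 𝒜) → ℝ}
    (hY : ∀ l, HasWeights q l → ∃ i, Y l ≤ pathSum (fun _ z => g i z) l) (n : ℕ) :
    SubgaussianOn q τ Y (m₀ * ν + 6 * D * ν * n + β / 2 ^ n * (q.map abs).sum)
      ((b + 3 * β) * ν) := by
  set γ : ℕ → ℝ := fun k => β / 2 ^ k with hγ
  have hγ0 : ∀ k, 0 < γ k := fun k => by positivity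
  have hγs : ∀ k, γ k = 2 * γ (k + 1) := fun k => by
    simp only [hγ, pow_succ]; field_simp
  -- Level `0` is the maximum over the coarsest cover; level `k + 1` is the maximum over pairs from
  -- consecutive covers of the clamped difference, bounded by `γ (k + 1) + γ k = 3 * γ (k + 1)`.
  set M : ℕ → List (ℝ × 𝒜) → ℝ := fun k => Nat.casesOn k
    (fun l => ⨆ e, pathSum (P 0 e) l)
    (fun k l => ⨆ c : E (k + 1) × E k, pathSum (fun h z => max (-(γ (k + 1) + γ k))
      (min (γ (k + 1) + γ k) (P (k + 1) c.1 h z - P k c.2 h z))) l) with hM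
  set m : ℕ → ℝ := fun k => Nat.casesOn k (m₀ * ν) (fun _ => 6 * D * ν) with hm
  set σ : ℕ → ℝ := fun k => Nat.casesOn k (b * ν) (fun k => 3 * γ (k + 1) * ν) with hσ
  have hσ0 : ∀ k, 0 < σ k := by
    rintro (_ | k)
    · exact mul_pos hb hν
    · exact mul_pos (mul_pos (by norm_num) (hγ0 _)) hν
  have hsub : ∀ k, SubgaussianOn q τ (M k) (m k) (σ k) := by
    rintro (_ | k)
    · refine (subgaussianOn_iSup_pathSum hb hν hq (hP 0) (hC0 0) (hE 0)).of_le
        (c := 0) (fun l _ => (add_zero _).ge) ?_ (abs_of_pos (hσ0 0)).le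
      calc b * ν * Real.sqrt (2 * C 0) + 0 = b * Real.sqrt (2 * C 0) * ν := by ring
        _ ≤ m₀ * ν := by gcongr
    · have hc : 0 < γ (k + 1) + γ k := add_pos (hγ0 _) (hγ0 _)
      have hcard : (Fintype.card (E (k + 1) × E k) : ℝ) ≤ Real.exp (C (k + 1) + C k) := by
        rw [Fintype.card_prod, Nat.cast_mul, Real.exp_add]
        exact mul_le_mul (hE _) (hE _) (Nat.cast_nonneg _) (Real.exp_pos _).le
      have hc3 : γ (k + 1) + γ k = 3 * γ (k + 1) := by rw [hγs k]; ring
      refine (subgaussianOn_iSup_pathSum (P := fun (c : E (k + 1) × E k) h z =>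
        max (-(γ (k + 1) + γ k)) (min (γ (k + 1) + γ k) (P (k + 1) c.1 h z - P k c.2 h z)))
        hc hν hq (fun e h z => abs_clamp_le hc.le _) (add_nonneg (hC0 _) (hC0 _)) hcard).of_le
        (c := 0) (fun l _ => (add_zero _).ge) ?_ ?_
      -- The entropy grows like `1 / γ²`, so its square root cancels the size `γ` of the link: every
      -- level has the same mean `6 * D * ν`.
      · have hsq : Real.sqrt (2 * (C (k + 1) + C k)) ≤ 2 * D / γ (k + 1) := by
          refine Real.sqrt_le_iff.2 ⟨by have := hγ0 (k + 1); positivity, ?_⟩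
          have h1 : C (k + 1) ≤ (D / γ (k + 1)) ^ 2 := hC (k + 1)
          have h2 : C k ≤ (D / γ k) ^ 2 := hC k
          have h3 : (D / γ k) ^ 2 = (D / γ (k + 1)) ^ 2 / 4 := by
            have := hγ0 (k + 1)
            rw [hγs k]; field_simp; norm_num
          have h4 : (2 * D / γ (k + 1)) ^ 2 = 4 * (D / γ (k + 1)) ^ 2 := by ring
          have h5 := sq_nonneg (D / γ (k + 1))
          rw [h4]
          linarith
        rw [hc3, add_zero]
        calc 3 * γ (k + 1) * ν * Real.sqrt (2 * (C (k + 1) + C k))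
            ≤ 3 * γ (k + 1) * ν * (2 * D / γ (k + 1)) := by
              have := hγ0 (k + 1)
              gcongr
          _ = 6 * D * ν := by
              have := hγ0 (k + 1)
              field_simp
              ring
      · rw [hc3]
        exact (abs_of_pos (hσ0 (k + 1))).le
  have hsum := SubgaussianOn.sum_range hsub hσ0 n
  refine hsum.of_le (c := β / 2 ^ n * (q.map abs).sum) (fun l hl => ?_) (le_of_eq ?_) ?_
  · obtain ⟨i, hi⟩ := hY l hl
    refine hi.trans ?_
    choose e he using fun k => hcover l hl i k
    have hchain : ∀ n, pathSum (P n (e n)) l ≤ ∑ k ∈ Finset.range (n + 1), M k l := by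
      intro n
      induction n with
      | zero =>
        rw [Finset.sum_range_one]
        exact le_ciSup (f := fun e => pathSum (P 0 e) l) (Set.finite_range _).bddAbove (e 0)
      | succ n ih =>
        rw [Finset.sum_range_succ]
        have h1 := ((he (n + 1)).triangle (he n)).pathSum_eq_clamp
        have h2 : pathSum (fun h z => max (-(γ (n + 1) + γ n))
            (min (γ (n + 1) + γ n) (P (n + 1) (e (n + 1)) h z - P n (e n) h z))) l
              ≤ M (n + 1) l :=
          le_ciSup (f := fun c : E (n + 1) × E n => pathSum (fun h z => max (-(γ (n + 1) + γ n))
            (min (γ (n + 1) + γ n) (P (n + 1) c.1 h z - P n c.2 h z))) l)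
            (Set.finite_range _).bddAbove (e (n + 1), e n)
        rw [h1] at h2
        linarith
    -- Below the finest scale the error is bounded crudely, by the scale times the `ℓ¹` norm of the
    -- weights.
    have hrem := CloseAlong.pathSum_sub_le hl ((he n).mono (s := fun _ z => g i z) (s' := P n (e n))
      fun h z hz => by rwa [abs_sub_comm])
    linarith [hchain n]
  · rw [Finset.sum_range_succ']
    have hm0 : m 0 = m₀ * ν := rfl
    have hms : ∀ k, m (k + 1) = 6 * D * ν := fun _ => rfl
    simp only [hm0, hms, Finset.sum_const, Finset.card_range, nsmul_eq_mul]
    ring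
  · have hgeom : ∀ n, ∑ k ∈ Finset.range n, γ (k + 1) = β - γ n := by
      intro n
      induction n with
      | zero => simp [hγ]
      | succ n ih => rw [Finset.sum_range_succ, ih, hγs n]; ring
    rw [abs_of_pos (Finset.sum_pos (fun k _ => hσ0 k) (by simp)), Finset.sum_range_succ']
    have hσz : σ 0 = b * ν := rfl
    have hσs : ∀ k, σ (k + 1) = 3 * γ (k + 1) * ν := fun _ => rfl
    simp only [hσz, hσs]
    rw [← Finset.sum_mul, ← Finset.mul_sum, hgeom]
    nlinarith [mul_pos (hγ0 n) hν]

/-- Uniform subgaussian bound for Lipschitz functions of bounded linear functionals. -/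
theorem subgaussianOn_of_lipschitz {ℋ : Type*} [NormedAddCommGroup ℋ] [InnerProductSpace ℝ ℋ]
    {ι : Type*} {x : 𝒜 → ℋ} {w : ι → ℋ} {G : 𝒜 → ℝ → ℝ} {r Λ L b ν : ℝ} (hr : 0 < r)
    (hΛ : 0 < Λ) (hL : 0 < L) (hb : 0 < b) (hν : 0 < ν) (hx : ∀ z, ‖x z‖ ≤ r)
    (hw : ∀ i, ‖w i‖ ≤ Λ) (hG : ∀ z u u', |G z u - G z u'| ≤ L * |u - u'|)
    (hGb : ∀ i z, |G z ⟪w i, x z⟫_ℝ| ≤ b) (hq : (q.map (· ^ 2)).sum = ν ^ 2) {n : ℕ}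
    (hn : (q.map abs).sum ≤ 2 ^ n * ν) {Y : List (ℝ × 𝒜) → ℝ}
    (hY : ∀ l, HasWeights q l → ∃ i, Y l ≤ pathSum (fun _ z => G z ⟪w i, x z⟫_ℝ) l) :
    SubgaussianOn q τ Y
      (L * (Λ * r) * ν * (6 * Real.sqrt (2 * Real.log (2 * q.length + 1)) * (n + 1) + 1))
      (2 * b * ν) := by
  set A := L * (Λ * r) with hA
  have hA0 : 0 < A := by positivity
  set ℓ := Real.log (2 * q.length + 1) with hℓ
  have hℓ0 : 0 ≤ ℓ := Real.log_nonneg (by linarith [Nat.cast_nonneg (α := ℝ) q.length])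
  set D := A * Real.sqrt (2 * ℓ) with hD
  have hD0 : 0 ≤ D := by positivity
  have hD2 : D ^ 2 = A ^ 2 * (2 * ℓ) := by
    rw [hD, mul_pow, Real.sq_sqrt (by positivity)]
  -- `b / 3` keeps the total standard deviation `(b + 3β)ν` below `2bν`; `A` is the largest
  -- oscillation of the class, beyond which a coarser scale is of no use.
  set β := min A (b / 3) with hβ
  have hβ0 : 0 < β := lt_min hA0 (by positivity)
  have general : ∀ γ : ℝ, 0 < γ → ∃ (S : Finset (ℕ → ℤ)) (P : (ℕ → ℤ) → List 𝒜 → 𝒜 → ℝ),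
      S.Nonempty ∧ (S.card : ℝ) ≤ Real.exp ((D / γ) ^ 2) ∧ (∀ j h z, |P j h z| ≤ b) ∧
      ∀ l, HasWeights q l → ∀ i, ∃ j ∈ S,
        CloseAlong γ (P j) (fun _ z => G z ⟪w i, x z⟫_ℝ) (l.map Prod.snd) := by
    intro γ hγ
    -- The linear functionals are covered at scale `γ / L`; composing with `G` and clamping to `[-b,
    -- b]` yields scale `γ` for the class.
    obtain ⟨S, hS, hcard, hclose⟩ := exists_cover (Λ := Λ) (div_pos hγ hL) hr hx q.length
    refine ⟨S, fun j h z => max (-b) (min b (G z (track (γ / L) x 0 j h z))), hS, ?_,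
      fun j h z => abs_clamp_le hb.le _, fun l hl i => ?_⟩
    · refine hcard.trans (Real.exp_le_exp.2 (le_of_eq ?_))
      rw [div_pow D, hD2, hA]
      field_simp
      rfl
    · obtain ⟨j, hj, hc⟩ := hclose (w i) (hw i) (l.map Prod.snd) (by simpa using hl.length_eq)
      refine ⟨j, hj, hc.mono (s' := fun _ z => G z ⟪w i, x z⟫_ℝ) fun h z hz => ?_⟩
      refine (abs_clamp_sub_le (hGb i z)).trans ((hG _ _ _).trans ?_)
      rw [le_div_iff₀ hL] at hz
      linarith
  have covers : ∀ k : ℕ, ∃ (S : Finset (ℕ → ℤ)) (P : (ℕ → ℤ) → List 𝒜 → 𝒜 → ℝ) (C : ℝ),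
      S.Nonempty ∧ (S.card : ℝ) ≤ Real.exp C ∧ 0 ≤ C ∧ C ≤ (D / (β / 2 ^ k)) ^ 2 ∧
      (k = 0 → b * Real.sqrt (2 * C) ≤ 5 * D) ∧ (∀ j h z, |P j h z| ≤ b) ∧
      ∀ l, HasWeights q l → ∀ i, ∃ j ∈ S,
        CloseAlong (β / 2 ^ k) (P j) (fun _ z => G z ⟪w i, x z⟫_ℝ) (l.map Prod.snd) := by
    intro k
    -- At the top scale with `β = A`, the single predictor with linear value `0` covers everything
    -- at no entropy. Otherwise `β = b / 3`, and the general cover is already cheap enough for a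
    -- level-zero mean of `5 * D`.
    by_cases hk : k = 0 ∧ A ≤ b / 3
    · obtain ⟨rfl, hAb⟩ := hk
      refine ⟨{0}, fun _ _ z => max (-b) (min b (G z 0)), 0, by simp, by simp, le_rfl, sq_nonneg _,
        fun _ => by simpa using hD0, fun _ _ _ => abs_clamp_le hb.le _, fun l _ i => ⟨0, by simp, ?_⟩⟩
      have hβA : β = A := min_eq_left hAb
      have hpt : ∀ z, |max (-b) (min b (G z 0)) - G z ⟪w i, x z⟫_ℝ| ≤ β / 2 ^ 0 := fun z => by
        refine (abs_clamp_sub_le (hGb i z)).trans ((hG _ _ _).trans ?_)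
        rw [pow_zero, div_one, hβA, hA, zero_sub, abs_neg]
        have := abs_real_inner_le_norm (w i) (x z)
        have h2 : ‖w i‖ * ‖x z‖ ≤ Λ * r :=
          mul_le_mul (hw i) (hx z) (norm_nonneg _) hΛ.le
        exact mul_le_mul_of_nonneg_left (this.trans h2) hL.le
      generalize l.map Prod.snd = l'
      induction l' with
      | nil => trivial
      | cons z l' ih => exact ⟨hpt z, ih⟩
    · have hγ : 0 < β / 2 ^ k := by positivity
      obtain ⟨S, P, hS, hcard, hP, hc⟩ := general _ hγ
      refine ⟨S, P, _, hS, hcard, sq_nonneg _, le_rfl, ?_, hP, hc⟩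
      rintro rfl
      have hβb : β = b / 3 := min_eq_right (not_le.1 fun h => hk ⟨rfl, h⟩).le
      rw [pow_zero, div_one, hβb, Real.sqrt_mul (by norm_num), Real.sqrt_sq (by positivity)]
      have h2 : Real.sqrt 2 ≤ 5 / 3 := Real.sqrt_le_iff.2 (by norm_num)
      calc b * (Real.sqrt 2 * (D / (b / 3))) = Real.sqrt 2 * (3 * D) := by field_simp
        _ ≤ 5 / 3 * (3 * D) := by gcongr
        _ = 5 * D := by ring
  choose S P C hS hcard hC0 hC hC1 hP hclose using covers
  have : ∀ k, Nonempty (S k) := fun k => (hS k).to_subtype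
  have main := subgaussianOn_of_covers (τ := τ) (g := fun i z => G z ⟪w i, x z⟫_ℝ) (m₀ := 5 * D)
    hb hβ0 hν hD0 hq (E := fun k => S k) (fun k e => P k e) (fun k e => hP k e)
    (fun k => by simpa using hcard k) hC0 hC (hC1 0 rfl)
    (fun l hl i k => by
      obtain ⟨j, hj, hc⟩ := hclose k l hl i
      exact ⟨⟨j, hj⟩, hc⟩) hY n
  refine main.of_le (c := 0) (fun l _ => (add_zero _).ge) ?_ ?_
  · have h1 : β / 2 ^ n * (q.map abs).sum ≤ A * ν := by
      calc β / 2 ^ n * (q.map abs).sum ≤ β / 2 ^ n * (2 ^ n * ν) := by gcongr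
        _ = β * ν := by field_simp
        _ ≤ A * ν := by gcongr; exact min_le_left _ _
    have h2 : A * ν * (6 * Real.sqrt (2 * ℓ) * (n + 1) + 1)
        = 6 * D * ν * n + 6 * D * ν + A * ν := by rw [hD]; ring
    rw [h2]
    have : 0 ≤ D * ν := by positivity
    linarith
  · rw [abs_of_pos (by positivity)]
    gcongr
    linarith [min_le_right A (b / 3)]

end Chaining

/-! ### Sequential symmetrization: from conditional means to trees of pairs. -/

section Symmetrization

variable {𝒵 ι : Type*}

theorem closeAlong_of_forall {𝒜 : Type*} {β : ℝ} {p p' : List 𝒜 → 𝒜 → ℝ}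
    (h : ∀ k z, |p k z - p' k z| ≤ β) (l : List 𝒜) : CloseAlong β p p' l := by
  induction l generalizing p p' with
  | nil => trivial
  | cons z l ih => exact ⟨h _ _, ih fun k y => h (z :: k) y⟩

theorem pathSum_zero {𝒜 : Type*} (l : List (ℝ × 𝒜)) : pathSum (fun _ _ => 0) l = 0 := by
  induction l with
  | nil => rfl
  | cons c l ih => simp [pathSum, ih]

/-- The exponential of the largest partial sum, started from `s`, along a path through a tree of
pairs of observations. -/
noncomputable def pathPotential (f : ι → 𝒵 → ℝ) (t : ℝ) (s : ι → ℝ) (l : List (ℝ × 𝒵 × 𝒵)) : ℝ :=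
  Real.exp (t * ⨆ i, (s i + pathSum (fun _ c => f i c.2 - f i c.1) l))

/-- The largest mean of the potential over all trees of pairs of observations. -/
noncomputable def treeValue (f : ι → 𝒵 → ℝ) (t : ℝ) (q : List ℝ) (s : ι → ℝ) : ℝ :=
  ⨆ τ : List Bool → 𝒵 × 𝒵, treeMean q τ (pathPotential f t s)

variable {f : ι → 𝒵 → ℝ} {t B : ℝ}

theorem treeMean_pathPotential_nonneg (q : List ℝ) (τ : List Bool → 𝒵 × 𝒵) (s : ι → ℝ) :
    0 ≤ treeMean q τ (pathPotential f t s) :=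
  (treeMean_pos q τ fun _ => Real.exp_pos _).le

theorem treeValue_nonneg (q : List ℝ) (s : ι → ℝ) : 0 ≤ treeValue f t q s :=
  Real.iSup_nonneg fun τ => treeMean_pathPotential_nonneg q τ s

theorem treeValue_nil [Nonempty 𝒵] (s : ι → ℝ) :
    treeValue f t [] s = Real.exp (t * ⨆ i, s i) := by
  simp [treeValue, treeMean, pathPotential, pathSum]

variable [Fintype ι] [Nonempty ι]

theorem bddAbove_treeMean (ht : 0 ≤ t) (hf : ∀ i z, |f i z| ≤ B) (q : List ℝ) (s : ι → ℝ) :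
    BddAbove (Set.range fun τ : List Bool → 𝒵 × 𝒵 => treeMean q τ (pathPotential f t s)) := by
  refine ⟨Real.exp (t * ((⨆ i, s i) + 2 * B * (q.map abs).sum)), ?_⟩
  rintro _ ⟨τ, rfl⟩
  refine (treeMean_mono q τ fun l hl => ?_).trans (treeMean_const q τ _).le
  refine Real.exp_le_exp.2 (mul_le_mul_of_nonneg_left (ciSup_le fun i => ?_) ht)
  refine add_le_add (le_ciSup (Set.finite_range s).bddAbove i) ?_
  have h := CloseAlong.pathSum_sub_le hl (closeAlong_of_forall (β := 2 * B)
    (p := fun _ c => f i c.2 - f i c.1) (p' := fun _ _ => 0) (fun _ c => ?_) _)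
  · rwa [pathSum_zero, sub_zero] at h
  · have h1 := abs_le.1 (hf i c.1)
    have h2 := abs_le.1 (hf i c.2)
    rw [sub_zero, abs_le]
    constructor <;> linarith

theorem pathPotential_convex (ht : 0 ≤ t) (l : List (ℝ × 𝒵 × 𝒵)) :
    ConvexOn ℝ Set.univ (fun s => pathPotential f t s l) := by
  refine ⟨convex_univ, fun s _ s' _ a b ha hb hab => ?_⟩
  set c : ι → ℝ := fun i => pathSum (fun _ c => f i c.2 - f i c.1) l with hc
  have h1 : (⨆ i, ((a • s + b • s') i + c i)) ≤ a * (⨆ i, (s i + c i)) + b * ⨆ i, (s' i + c i) := by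
    refine ciSup_le fun i => ?_
    have h2 := mul_le_mul_of_nonneg_left
      (le_ciSup (f := fun i => s i + c i) (Set.finite_range _).bddAbove i) ha
    have h3 := mul_le_mul_of_nonneg_left
      (le_ciSup (f := fun i => s' i + c i) (Set.finite_range _).bddAbove i) hb
    have h4 : (a • s + b • s') i + c i = a * (s i + c i) + b * (s' i + c i) := by
      simp only [Pi.add_apply, Pi.smul_apply, smul_eq_mul]
      linear_combination (-c i) * hab
    rw [h4]
    exact add_le_add h2 h3
  have h5 := convexOn_exp.2 (Set.mem_univ (t * ⨆ i, (s i + c i)))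
    (Set.mem_univ (t * ⨆ i, (s' i + c i))) ha hb hab
  refine le_trans (Real.exp_le_exp.2 ?_) h5
  refine (mul_le_mul_of_nonneg_left h1 ht).trans (le_of_eq ?_)
  simp only [smul_eq_mul]
  ring

/-- Convexity serves twice: for Jensen's inequality in the symmetrization step, and, the index type
being finite, for continuity. Continuity makes this supremum over uncountably many trees measurable.
-/
theorem treeValue_convex [Nonempty 𝒵] (ht : 0 ≤ t) (hf : ∀ i z, |f i z| ≤ B) (q : List ℝ) :
    ConvexOn ℝ Set.univ (treeValue f t q) := by
  refine ⟨convex_univ, fun s _ s' _ a b ha hb hab => ciSup_le fun τ => ?_⟩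
  calc _ ≤ treeMean q τ (fun l => a * pathPotential f t s l + b * pathPotential f t s' l) :=
        treeMean_mono q τ fun l _ =>
          (pathPotential_convex ht l).2 (Set.mem_univ s) (Set.mem_univ s') ha hb hab
    _ = a * treeMean q τ (pathPotential f t s) + b * treeMean q τ (pathPotential f t s') := by
        rw [treeMean_add, treeMean_const_mul, treeMean_const_mul]
    _ ≤ _ := add_le_add
        (mul_le_mul_of_nonneg_left (le_ciSup (bddAbove_treeMean ht hf q s) τ) ha)
        (mul_le_mul_of_nonneg_left (le_ciSup (bddAbove_treeMean ht hf q s') τ) hb)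

theorem continuous_treeValue [Nonempty 𝒵] (ht : 0 ≤ t) (hf : ∀ i z, |f i z| ≤ B) (q : List ℝ) :
    Continuous (treeValue f t q) :=
  continuousOn_univ.1 ((treeValue_convex ht hf q).continuousOn isOpen_univ)

/-- Two trees, chosen independently of each other, are glued under the root `(z, z')`; the sign at
the root decides which one is followed. Taking the supremum over each separately gives the bound. -/
theorem treeValue_average_le (ht : 0 ≤ t) (hf : ∀ i z, |f i z| ≤ B) (a : ℝ) (q : List ℝ)
    (s : ι → ℝ) (z z' : 𝒵) :
    treeValue f t q (fun i => s i + a * (f i z' - f i z))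
      + treeValue f t q (fun i => s i + a * (f i z - f i z')) ≤ 2 * treeValue f t (a :: q) s := by
  have : Nonempty 𝒵 := ⟨z⟩
  have key : ∀ τ τ' : List Bool → 𝒵 × 𝒵,
      treeMean q τ (pathPotential f t fun i => s i + a * (f i z' - f i z))
        + treeMean q τ' (pathPotential f t fun i => s i + a * (f i z - f i z'))
        ≤ 2 * treeValue f t (a :: q) s := fun τ τ' => by
    set ρ : List Bool → 𝒵 × 𝒵 := fun h => match h with
      | [] => (z, z')
      | true :: h => τ h
      | false :: h => τ' h
    have h := le_ciSup (bddAbove_treeMean ht hf (a :: q) s) ρ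
    have e1 : (fun l => pathPotential f t s ((a, ρ []) :: l))
        = pathPotential f t fun i => s i + a * (f i z' - f i z) := by
      funext l
      simp only [pathPotential, pathSum, ρ, add_assoc]
    have e2 : (fun l => pathPotential f t s ((-a, ρ []) :: l))
        = pathPotential f t fun i => s i + a * (f i z - f i z') := by
      funext l
      simp only [pathPotential, pathSum, ρ]
      congr 3
      funext i
      ring
    simp only [treeMean, e1, e2] at h
    change (treeMean q τ _ + treeMean q τ' _) / 2 ≤ treeValue f t (a :: q) s at h
    linarith
  have h1 : treeValue f t q (fun i => s i + a * (f i z - f i z'))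
      ≤ 2 * treeValue f t (a :: q) s
        - treeValue f t q (fun i => s i + a * (f i z' - f i z)) := by
    refine ciSup_le fun τ' => ?_
    have h2 : treeValue f t q (fun i => s i + a * (f i z' - f i z))
        ≤ 2 * treeValue f t (a :: q) s
          - treeMean q τ' (pathPotential f t fun i => s i + a * (f i z - f i z')) :=
      ciSup_le fun τ => by linarith [key τ τ']
    linarith
  linarith

/-- The two coordinates are exchangeable under `ν.prod ν`, so the integral does not change when `H`
is averaged with its swap. -/
theorem integral_integral_le_of_average_le {𝒵 : Type*} [MeasurableSpace 𝒵] {ν : Measure 𝒵}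
    [IsProbabilityMeasure ν] {H : 𝒵 → 𝒵 → ℝ} {C : ℝ}
    (hH : Integrable (fun c : 𝒵 × 𝒵 => H c.1 c.2) (ν.prod ν))
    (hC : ∀ z z', H z z' + H z' z ≤ 2 * C) : ∫ z, ∫ z', H z z' ∂ν ∂ν ≤ C := by
  have hH' : Integrable (fun c : 𝒵 × 𝒵 => H c.2 c.1) (ν.prod ν) := hH.swap
  have h1 : ∫ c : 𝒵 × 𝒵, H c.2 c.1 ∂(ν.prod ν) = ∫ c : 𝒵 × 𝒵, H c.1 c.2 ∂(ν.prod ν) :=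
    integral_prod_swap (μ := ν) (ν := ν) (fun c : 𝒵 × 𝒵 => H c.1 c.2)
  have h2 : ∫ c : 𝒵 × 𝒵, (H c.1 c.2 + H c.2 c.1) ∂(ν.prod ν) ≤ 2 * C := by
    calc _ ≤ ∫ _c : 𝒵 × 𝒵, 2 * C ∂(ν.prod ν) :=
          integral_mono (hH.add hH') (integrable_const _) fun c => hC c.1 c.2
      _ = _ := by simp
  rw [integral_add hH hH', h1] at h2
  rw [integral_integral (f := H) hH]
  linarith

variable [MeasurableSpace 𝒵]

/-- One step of symmetrization. -/
theorem lintegral_treeValue_le (ht : 0 ≤ t) (hf : ∀ i z, |f i z| ≤ B)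
    (hfm : ∀ i, Measurable (f i)) (a : ℝ) (q : List ℝ) (s : ι → ℝ) (ν : Measure 𝒵)
    [IsProbabilityMeasure ν] :
    ∫⁻ z, ENNReal.ofReal (treeValue f t q fun i => s i + a * ((∫ y, f i y ∂ν) - f i z)) ∂ν
      ≤ ENNReal.ofReal (treeValue f t (a :: q) s) := by
  have : Nonempty 𝒵 := nonempty_of_isProbabilityMeasure ν
  have hcont := continuous_treeValue ht hf q
  have hfi : ∀ i, Integrable (f i) ν := fun i =>
    Integrable.of_bound (hfm i).aestronglyMeasurable B (ae_of_all _ fun z => hf i z)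
  -- One step moves the partial sums by at most `|a| * (2 * B)`; compactness of that ball bounds
  -- every integrand below and so gives integrability.
  obtain ⟨K, hK⟩ := (isCompact_closedBall s (|a| * (2 * B))).exists_bound_of_continuousOn
    hcont.continuousOn
  have hB : 0 ≤ B := (abs_nonneg _).trans (hf (Classical.arbitrary ι) (Classical.arbitrary 𝒵))
  have hKs : ∀ d : ι → ℝ, (∀ i, |d i| ≤ 2 * B) → ‖treeValue f t q fun i => s i + a * d i‖ ≤ K := by
    intro d hd
    refine hK _ ?_
    rw [Metric.mem_closedBall, dist_pi_le_iff (by positivity)]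
    intro i
    rw [Real.dist_eq, add_sub_cancel_left, abs_mul]
    exact mul_le_mul_of_nonneg_left (hd i) (abs_nonneg a)
  have hsub : ∀ {u v : ℝ}, |u| ≤ B → |v| ≤ B → |u - v| ≤ 2 * B := fun hu hv => by
    rw [abs_le] at *
    constructor <;> linarith
  have hmean : ∀ i, |∫ y, f i y ∂ν| ≤ B := fun i => by
    simpa using norm_integral_le_of_norm_le_const (μ := ν) (f := f i) (C := B) (ae_of_all _ fun z => hf i z)
  have hHm : Measurable fun c : 𝒵 × 𝒵 =>
      treeValue f t q fun i => s i + a * (f i c.2 - f i c.1) := by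
    refine hcont.measurable.comp (measurable_pi_lambda _ fun i => ?_)
    have := hfm i
    fun_prop
  have hHi : Integrable (fun c : 𝒵 × 𝒵 =>
      treeValue f t q fun i => s i + a * (f i c.2 - f i c.1)) (ν.prod ν) :=
    Integrable.of_bound hHm.aestronglyMeasurable K
      (ae_of_all _ fun c => hKs _ fun i => hsub (hf i _) (hf i _))
  have hJi : Integrable (fun z =>
      treeValue f t q fun i => s i + a * ((∫ y, f i y ∂ν) - f i z)) ν := by
    refine Integrable.of_bound (Measurable.aestronglyMeasurable ?_) K
      (ae_of_all _ fun c => hKs _ fun i => hsub (hmean i) (hf i _))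
    refine hcont.measurable.comp (measurable_pi_lambda _ fun i => ?_)
    have := hfm i
    fun_prop
  -- The mean of `f i` is written as an integral over an independent copy `z'` and taken outside the
  -- convex function.
  have hjensen : ∀ z, treeValue f t q (fun i => s i + a * ((∫ y, f i y ∂ν) - f i z))
      ≤ ∫ z', treeValue f t q (fun i => s i + a * (f i z' - f i z)) ∂ν := by
    intro z
    have hai : ∀ i, Integrable (fun z' => a * (f i z' - f i z)) ν := fun i =>
      ((hfi i).sub (integrable_const _)).const_mul a
    have hvi : ∀ i, Integrable (fun z' => s i + a * (f i z' - f i z)) ν := fun i =>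
      (integrable_const _).add (hai i)
    have h := (treeValue_convex ht hf q).map_integral_le (μ := ν)
      (f := fun z' => fun i => s i + a * (f i z' - f i z)) hcont.continuousOn isClosed_univ
      (ae_of_all _ fun _ => Set.mem_univ _) (Integrable.of_eval hvi) ?_
    · have e : (∫ z', (fun i => s i + a * (f i z' - f i z)) ∂ν)
          = fun i => s i + a * ((∫ y, f i y ∂ν) - f i z) := by
        funext i
        rw [eval_integral hvi, integral_add (integrable_const _) (hai i), integral_const_mul,
          integral_sub (hfi i) (integrable_const _)]
        simp
      rwa [e] at h
    · refine Integrable.of_bound (Measurable.aestronglyMeasurable ?_) K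
        (ae_of_all _ fun c => hKs _ fun i => hsub (hf i _) (hf i _))
      refine hcont.measurable.comp (measurable_pi_lambda _ fun i => ?_)
      have := hfm i
      fun_prop
  have havg : ∀ z z', treeValue f t q (fun i => s i + a * (f i z' - f i z))
      + treeValue f t q (fun i => s i + a * (f i z - f i z')) ≤ 2 * treeValue f t (a :: q) s :=
    treeValue_average_le ht hf a q s
  rw [← ofReal_integral_eq_lintegral_ofReal hJi (ae_of_all _ fun z => treeValue_nonneg q _)]
  refine ENNReal.ofReal_le_ofReal ((integral_mono hJi hHi.integral_prod_left hjensen).trans ?_)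
  exact integral_integral_le_of_average_le (H := fun z z' =>
    treeValue f t q fun i => s i + a * (f i z' - f i z)) hHi havg

end Symmetrization

/-! ### Exponential moments of the deviation along the process. -/

section Deviation

variable {Ω 𝒵 ι : Type*} [MeasurableSpace Ω] [MeasurableSpace 𝒵] [Fintype ι] [Nonempty ι]
  {κ : (t : ℕ) → Kernel (Fin t → 𝒵) 𝒵} {f : ι → 𝒵 → ℝ} {B : ℝ}

/-- The weighted sum of the first `t` deviations of `f` from its conditional means. -/
noncomputable def deviation (κ : (t : ℕ) → Kernel (Fin t → 𝒵) 𝒵) (q : ℕ → ℝ) (f : 𝒵 → ℝ) (t : ℕ)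
    (ζ : ℕ → 𝒵) : ℝ :=
  ∑ k ∈ Finset.range t, q k * (condMean κ f k ζ - f (ζ k))

theorem measurable_condMean_past [∀ t, IsMarkovKernel (κ t)] {g : 𝒵 → ℝ} (hg : Measurable g)
    (k : ℕ) : Measurable fun y : Fin k → 𝒵 => ∫ z, g z ∂(κ k y) := by
  refine StronglyMeasurable.measurable ?_
  exact MeasureTheory.StronglyMeasurable.integral_kernel hg.stronglyMeasurable

theorem lintegral_deviation_step {t : ℝ} (ht : 0 ≤ t) (hf : ∀ i z, |f i z| ≤ B)
    (hfm : ∀ i, Measurable (f i)) {μ : Measure Ω} [IsProbabilityMeasure μ]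
    [∀ t, IsMarkovKernel (κ t)] {Z : ℕ → Ω → 𝒵} {n : ℕ}
    (hZ : HasCondDistrib (Z n) (fun ω (i : Fin n) => Z i ω) (κ n) μ) (q : ℕ → ℝ) (ql : List ℝ) :
    ∫⁻ ω, ENNReal.ofReal
        (treeValue f t ql fun i => deviation κ q (f i) (n + 1) fun k => Z k ω) ∂μ
      ≤ ∫⁻ ω, ENNReal.ofReal
        (treeValue f t (q n :: ql) fun i => deviation κ q (f i) n fun k => Z k ω) ∂μ := by
  have : Nonempty Ω := nonempty_of_isProbabilityMeasure μ
  have : Nonempty 𝒵 := ⟨Z 0 (Classical.arbitrary Ω)⟩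
  set σ : (Fin n → 𝒵) → ι → ℝ := fun y i => ∑ k : Fin n,
    q k * ((∫ z, f i z ∂(κ k fun j : Fin k => y ⟨j, j.2.trans k.2⟩)) - f i (y k)) with hσ
  have hσm : Measurable σ := by
    refine measurable_pi_lambda _ fun i => Finset.measurable_sum _ fun k _ => ?_
    refine Measurable.const_mul (Measurable.sub ?_ ?_) _
    · exact (measurable_condMean_past (hfm i) k).comp
        (measurable_pi_lambda _ fun j => measurable_pi_apply _)
    · exact (hfm i).comp (measurable_pi_apply k)
  have hdev : ∀ ω, (fun i => deviation κ q (f i) n fun k => Z k ω)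
      = σ fun i : Fin n => Z i ω := fun ω => by
    funext i
    rw [deviation, Finset.sum_range]
    rfl
  have hdev' : ∀ ω, (fun i => deviation κ q (f i) (n + 1) fun k => Z k ω)
      = fun i => σ (fun i : Fin n => Z i ω) i
        + q n * ((∫ z, f i z ∂(κ n fun j : Fin n => Z j ω)) - f i (Z n ω)) := fun ω => by
    funext i
    rw [← hdev, deviation, Finset.sum_range_succ]
    rfl
  have hm : Measurable fun c : (Fin n → 𝒵) × 𝒵 => ENNReal.ofReal
      (treeValue f t ql fun i => σ c.1 i + q n * ((∫ z, f i z ∂(κ n c.1)) - f i c.2)) := by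
    refine ENNReal.measurable_ofReal.comp ((continuous_treeValue ht hf ql).measurable.comp
      (measurable_pi_lambda _ fun i => ?_))
    refine Measurable.add ((measurable_pi_apply i).comp (hσm.comp measurable_fst)) ?_
    exact Measurable.const_mul (((measurable_condMean_past (hfm i) n).comp measurable_fst).sub
      ((hfm i).comp measurable_snd)) _
  have hm' : Measurable fun y => ENNReal.ofReal (treeValue f t (q n :: ql) (σ y)) :=
    ENNReal.measurable_ofReal.comp
      ((continuous_treeValue ht hf _).measurable.comp hσm)
  simp only [hdev, hdev']
  -- The joint law of the past and the next observation is a composition product, so the inner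
  -- integral is the one-step symmetrization for the measure `κ n y` with the past frozen.
  have hlaw := hZ.map_eq
  calc _ = ∫⁻ c, ENNReal.ofReal
          (treeValue f t ql fun i => σ c.1 i + q n * ((∫ z, f i z ∂(κ n c.1)) - f i c.2))
          ∂(μ.map fun ω => ((fun i : Fin n => Z i ω), Z n ω)) :=
        (lintegral_map' hm.aemeasurable hZ.aemeasurable).symm
    _ = ∫⁻ y, ∫⁻ z, ENNReal.ofReal
          (treeValue f t ql fun i => σ y i + q n * ((∫ z, f i z ∂(κ n y)) - f i z)) ∂(κ n y)
          ∂(μ.map fun ω (i : Fin n) => Z i ω) := by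
        rw [hlaw, Measure.lintegral_compProd hm]
    _ ≤ ∫⁻ y, ENNReal.ofReal (treeValue f t (q n :: ql) (σ y))
          ∂(μ.map fun ω (i : Fin n) => Z i ω) :=
        lintegral_mono fun y => lintegral_treeValue_le ht hf hfm (q n) ql (σ y) (κ n y)
    _ = _ := lintegral_map' hm'.aemeasurable hZ.aemeasurable_fst

/-- The exponential moments of the uniform deviation are bounded by the value of the tree game. -/
theorem lintegral_exp_deviation_le {t : ℝ} (ht : 0 ≤ t) (hf : ∀ i z, |f i z| ≤ B)
    (hfm : ∀ i, Measurable (f i)) {μ : Measure Ω} [IsProbabilityMeasure μ]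
    [∀ t, IsMarkovKernel (κ t)] {Z : ℕ → Ω → 𝒵} {T : ℕ}
    (hZ : ∀ n < T, HasCondDistrib (Z n) (fun ω (i : Fin n) => Z i ω) (κ n) μ) (q : ℕ → ℝ) :
    ∫⁻ ω, ENNReal.ofReal (Real.exp (t * ⨆ i, deviation κ q (f i) T fun k => Z k ω)) ∂μ
      ≤ ENNReal.ofReal (treeValue f t (List.ofFn fun k : Fin T => q k) fun _ => 0) := by
  have : Nonempty Ω := nonempty_of_isProbabilityMeasure μ
  have : Nonempty 𝒵 := ⟨Z 0 (Classical.arbitrary Ω)⟩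
  -- The last `n` observations have been replaced by a tree game with their weights, started from
  -- the partial sums at time `m`; each further step absorbs the latest observation that remains.
  have key : ∀ n m : ℕ, m + n ≤ T →
      ∫⁻ ω, ENNReal.ofReal (Real.exp (t * ⨆ i, deviation κ q (f i) (m + n) fun k => Z k ω)) ∂μ
        ≤ ∫⁻ ω, ENNReal.ofReal (treeValue f t (List.ofFn fun k : Fin n => q (m + k))
            fun i => deviation κ q (f i) m fun k => Z k ω) ∂μ := by
    intro n
    induction n with
    | zero => intro m _; simp [treeValue_nil]
    | succ n ih =>
      intro m hm
      have h1 := ih (m + 1) (by lia)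
      have h2 := lintegral_deviation_step ht hf hfm (hZ m (by lia)) q
        (List.ofFn fun k : Fin n => q (m + 1 + k))
      rw [show m + 1 + n = m + (n + 1) by ring] at h1
      have e : (List.ofFn fun k : Fin (n + 1) => q (m + k))
          = q m :: List.ofFn fun k : Fin n => q (m + 1 + k) := by
        rw [List.ofFn_succ]
        simp [add_assoc, add_comm 1]
      rw [e]
      exact h1.trans h2
  have h := key T 0 (by lia)
  simpa [deviation] using h

end Deviation

/-! ### The power losses as a Lipschitz class. -/

section Losses

/-- If `Λ` or `r` vanishes, all linear functionals are zero and a single predictor remains. The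
bound on `x` is asked for only when `0 < Λ`, because for `Λ = 0` nothing forces the kernel to be
bounded. -/
theorem subgaussianOn_of_lipschitz_of_nonneg {𝒜 ι ℋ : Type*} [Nonempty ι] [NormedAddCommGroup ℋ]
    [InnerProductSpace ℝ ℋ] {q : List ℝ} {τ : List Bool → 𝒜} {x : 𝒜 → ℋ} {w : ι → ℋ}
    {G : 𝒜 → ℝ → ℝ} {r Λ L b ν : ℝ} (hr : 0 ≤ r)
    (hΛ : 0 ≤ Λ) (hL : 0 < L) (hb : 0 < b) (hν : 0 < ν) (hx : 0 < Λ → ∀ z, ‖x z‖ ≤ r)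
    (hw : ∀ i, ‖w i‖ ≤ Λ) (hG : ∀ z u u', |G z u - G z u'| ≤ L * |u - u'|)
    (hGb : ∀ i z, |G z ⟪w i, x z⟫_ℝ| ≤ b) (hq : (q.map (· ^ 2)).sum = ν ^ 2) {n : ℕ}
    (hn : (q.map abs).sum ≤ 2 ^ n * ν) {Y : List (ℝ × 𝒜) → ℝ}
    (hY : ∀ l, HasWeights q l → ∃ i, Y l ≤ pathSum (fun _ z => G z ⟪w i, x z⟫_ℝ) l) :
    SubgaussianOn q τ Y
      (L * (Λ * r) * ν * (6 * Real.sqrt (2 * Real.log (2 * q.length + 1)) * (n + 1) + 1))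
      (2 * b * ν) := by
  by_cases h : 0 < Λ ∧ 0 < r
  · exact subgaussianOn_of_lipschitz h.2 h.1 hL hb hν (hx h.1) hw hG hGb hq hn hY
  have hzero : ∀ i z, ⟪w i, x z⟫_ℝ = 0 := fun i z => by
    rcases hΛ.eq_or_lt with h0 | h0
    · rw [norm_le_zero_iff.1 ((hw i).trans h0.ge), inner_zero_left]
    · have hr0 : r ≤ 0 := not_lt.1 fun h' => h ⟨h0, h'⟩
      rw [norm_le_zero_iff.1 ((hx h0 z).trans hr0), inner_zero_right]
  have hprod : Λ * r = 0 := by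
    rcases hΛ.eq_or_lt with h0 | h0
    · rw [← h0, zero_mul]
    · rw [le_antisymm (not_lt.1 fun h' => h ⟨h0, h'⟩) hr, mul_zero]
  have hP : ∀ (_ : List 𝒜) z, |G z 0| ≤ b := fun _ z => by
    simpa [hzero] using hGb (Classical.arbitrary ι) z
  refine (subgaussianOn_pathSum (p := fun _ z => G z 0) hP hq).of_le (c := 0) (fun l hl => ?_) ?_ ?_
  · obtain ⟨i, hi⟩ := hY l hl
    simpa [hzero] using hi
  · simp [hprod]
  · rw [abs_of_pos (by positivity)]
    nlinarith [mul_pos hb hν]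

/-- The supremum of differences is split into one supremum for each member of the pair; the centring
`b` cancels in the difference, so it is free to be chosen. -/
theorem treeValue_le_of_subgaussianOn {𝒵 ι : Type*} [Fintype ι] [Nonempty ι] [Nonempty 𝒵]
    {f : ι → 𝒵 → ℝ} {q : List ℝ} {b m σ t : ℝ} (ht : 0 ≤ t) (hσ : 0 < σ)
    (h₁ : ∀ τ : List Bool → 𝒵 × 𝒵,
      SubgaussianOn q τ (fun l => ⨆ i, pathSum (fun _ c => f i c.2 - b) l) m σ)
    (h₂ : ∀ τ : List Bool → 𝒵 × 𝒵,
      SubgaussianOn q τ (fun l => ⨆ i, pathSum (fun _ c => -(f i c.1 - b)) l) m σ) :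
    treeValue f t q (fun _ => 0) ≤ Real.exp (t * (2 * m) + t ^ 2 * (2 * σ) ^ 2 / 2) := by
  refine ciSup_le fun τ => ?_
  have h := (h₁ τ).add (h₂ τ) hσ hσ t ht
  rw [← two_mul, ← two_mul] at h
  refine le_trans (treeMean_mono q τ fun l _ => ?_) h
  refine Real.exp_le_exp.2 (mul_le_mul_of_nonneg_left (ciSup_le fun i => ?_) ht)
  have e := pathSum_sub (fun _ c => f i c.2 - b) (fun _ c => f i c.1 - b) l
  have e' := pathSum_neg (fun _ c => f i c.1 - b) l
  simp only [sub_sub_sub_cancel_right] at e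
  rw [zero_add, e, sub_eq_add_neg, ← e']
  exact add_le_add
    (le_ciSup (f := fun i => pathSum (fun _ c => f i c.2 - b) l)
      (Set.finite_range _).bddAbove i)
    (le_ciSup (f := fun i => pathSum (fun _ c => -(f i c.1 - b)) l)
      (Set.finite_range _).bddAbove i)

theorem abs_rpow_sub_rpow_le {p M s s' : ℝ} (hp : 1 ≤ p) (hs : s ∈ Set.Icc 0 M)
    (hs' : s' ∈ Set.Icc 0 M) : |s ^ p - s' ^ p| ≤ p * M ^ (p - 1) * |s - s'| := by
  have h := (convex_Icc (0 : ℝ) M).norm_image_sub_le_of_norm_hasDerivWithin_le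
    (f := fun s : ℝ => s ^ p) (f' := fun s => p * s ^ (p - 1)) (C := p * M ^ (p - 1))
    (fun x _ => (Real.hasDerivAt_rpow_const (Or.inr hp)).hasDerivWithinAt) (fun x hx => ?_) hs' hs
  · simpa [Real.norm_eq_abs] using h
  · rw [Real.norm_eq_abs, abs_of_nonneg (mul_nonneg (by linarith) (Real.rpow_nonneg hx.1 _))]
    exact mul_le_mul_of_nonneg_left (Real.rpow_le_rpow hx.1 hx.2 (by linarith)) (by linarith)

/-- The power loss as a function of the prediction, with the residual truncated at `M`. -/
noncomputable def truncatedLoss (p M y u : ℝ) : ℝ := min |u - y| M ^ p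

/-- The covering predictors may leave the range where residuals are at most `M`. Truncation keeps
the loss Lipschitz there and does not change it on the hypotheses themselves. -/
theorem truncatedLoss_lipschitz {p M : ℝ} (hp : 1 ≤ p) (hM : 0 ≤ M) (y u u' : ℝ) :
    |truncatedLoss p M y u - truncatedLoss p M y u'| ≤ p * M ^ (p - 1) * |u - u'| := by
  refine (abs_rpow_sub_rpow_le hp ⟨le_min (abs_nonneg _) hM, min_le_right _ _⟩
    ⟨le_min (abs_nonneg _) hM, min_le_right _ _⟩).trans ?_
  refine mul_le_mul_of_nonneg_left ?_ (mul_nonneg (by linarith) (Real.rpow_nonneg hM _))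
  refine (abs_min_sub_min_le_max _ _ _ _).trans (max_le ?_ (by simp))
  refine (abs_abs_sub_abs_le_abs_sub _ _).trans (le_of_eq ?_)
  ring_nf

theorem powerLoss_nonneg {𝒳 : Type*} {𝒴 : Set ℝ} (p : ℝ) (h : 𝒳 → ℝ) (z : 𝒳 × 𝒴) :
    0 ≤ powerLoss p h z :=
  Real.rpow_nonneg (abs_nonneg _) _

variable {𝒳 ℋ ι : Type*} [NormedAddCommGroup ℋ] [InnerProductSpace ℝ ℋ] {𝒴 : Set ℝ}

theorem treeValue_powerLoss_le [Fintype ι] [Nonempty ι] [Nonempty (𝒳 × 𝒴)] {Ψ : 𝒳 → ℋ}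
    {w : ι → ℋ} {q : List ℝ} {p M B Λ r ν t : ℝ} (ht : 0 ≤ t) (hp : 1 ≤ p) (hM : 1 ≤ M)
    (hB : 0 < B) (hν : 0 < ν) (hΛ : 0 ≤ Λ) (hr : 0 ≤ r) (hw : ∀ i, ‖w i‖ ≤ Λ)
    (hΨ : 0 < Λ → ∀ x, ‖Ψ x‖ ≤ r) (hres : ∀ i x (y : 𝒴), |⟪w i, Ψ x⟫_ℝ - (y : ℝ)| ≤ M)
    (hloss : ∀ i (z : 𝒳 × 𝒴), |powerLoss p (fun x => ⟪w i, Ψ x⟫_ℝ) z| ≤ B)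
    (hq : (q.map (· ^ 2)).sum = ν ^ 2) {n : ℕ} (hn : (q.map abs).sum ≤ 2 ^ n * ν) :
    treeValue (fun i (z : 𝒳 × 𝒴) => powerLoss p (fun x => ⟪w i, Ψ x⟫_ℝ) z) t q (fun _ => 0)
      ≤ Real.exp (t * (2 * (p * M ^ (p - 1) * (Λ * r) * ν *
          (6 * Real.sqrt (2 * Real.log (2 * q.length + 1)) * (n + 1) + 1)))
        + t ^ 2 * (2 * (B * ν)) ^ 2 / 2) := by
  have hL : 0 < p * M ^ (p - 1) := mul_pos (by linarith) (Real.rpow_pos_of_pos (by linarith) _)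
  have heq : ∀ i (z : 𝒳 × 𝒴),
      truncatedLoss p M z.2 ⟪w i, Ψ z.1⟫_ℝ = powerLoss p (fun x => ⟪w i, Ψ x⟫_ℝ) z := fun i z => by
    rw [truncatedLoss, min_eq_left (hres i _ _), powerLoss]
  -- Losses are nonnegative, so centring at `B / 2` halves the bound. Each half of the pair then has
  -- standard deviation `B * ν`, and together they give the factor `2 * B` of the confidence term.
  have hbd : ∀ i (z : 𝒳 × 𝒴), |powerLoss p (fun x => ⟪w i, Ψ x⟫_ℝ) z - B / 2| ≤ B / 2 :=
    fun i z => by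
      have h1 := powerLoss_nonneg p (fun x => ⟪w i, Ψ x⟫_ℝ) z
      have h2 := (abs_le.1 (hloss i z)).2
      rw [abs_le]
      constructor <;> linarith
  refine treeValue_le_of_subgaussianOn (b := B / 2) ht (by positivity) (fun τ => ?_) (fun τ => ?_)
  · have h := subgaussianOn_of_lipschitz_of_nonneg (q := q) (τ := τ) (x := fun c => Ψ c.2.1) (w := w)
      (G := fun c u => truncatedLoss p M c.2.2 u - B / 2) (b := B / 2) hr hΛ hL (by positivity) hν
      (fun h c => hΨ h _) hw
      (fun c u u' => by
        rw [sub_sub_sub_cancel_right]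
        exact truncatedLoss_lipschitz hp (by linarith) _ _ _)
      (fun i c => by rw [heq]; exact hbd i _) hq hn
      (Y := fun l => ⨆ i, pathSum (fun _ c => powerLoss p (fun x => ⟪w i, Ψ x⟫_ℝ) c.2 - B / 2) l)
      (fun l _ => by
        obtain ⟨i, hi⟩ := exists_eq_ciSup_of_finite (f := fun i =>
          pathSum (fun _ c => powerLoss p (fun x => ⟪w i, Ψ x⟫_ℝ) (c.2 : 𝒳 × 𝒴) - B / 2) l)
        exact ⟨i, by simp only [heq]; exact hi.ge⟩)
    rwa [mul_div_cancel₀ _ (two_ne_zero' ℝ)] at h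
  · have h := subgaussianOn_of_lipschitz_of_nonneg (q := q) (τ := τ) (x := fun c => Ψ c.1.1) (w := w)
      (G := fun c u => -(truncatedLoss p M c.1.2 u - B / 2)) (b := B / 2) hr hΛ hL (by positivity) hν
      (fun h c => hΨ h _) hw
      (fun c u u' => by
        rw [neg_sub_neg, sub_sub_sub_cancel_right, abs_sub_comm]
        exact truncatedLoss_lipschitz hp (by linarith) _ _ _)
      (fun i c => by rw [heq, abs_neg]; exact hbd i _) hq hn
      (Y := fun l => ⨆ i, pathSum (fun _ c => -(powerLoss p (fun x => ⟪w i, Ψ x⟫_ℝ) c.1 - B / 2)) l)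
      (fun l _ => by
        obtain ⟨i, hi⟩ := exists_eq_ciSup_of_finite (f := fun i =>
          pathSum (fun _ c => -(powerLoss p (fun x => ⟪w i, Ψ x⟫_ℝ) (c.1 : 𝒳 × 𝒴) - B / 2)) l)
        exact ⟨i, by simp only [heq]; exact hi.ge⟩)
    rwa [mul_div_cancel₀ _ (two_ne_zero' ℝ)] at h

end Losses

/-! ### Numerical bounds on the complexity constant. -/

section Constants

theorem one_le_log_exp_one_mul_sq {T : ℕ} (hT : 2 ≤ T) :
    Real.log (Real.exp 1 * (T : ℝ) ^ 2) = 1 + 2 * Real.log T ∧ 1 / 2 ≤ Real.log T := by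
  have hT' : (2 : ℝ) ≤ T := by exact_mod_cast hT
  constructor
  · rw [Real.log_mul (Real.exp_pos 1).ne' (by positivity), Real.log_exp, Real.log_pow]
    push_cast
    ring
  · have := Real.log_le_log (by norm_num) hT'
    linarith [Real.log_two_gt_d9]

theorem rpow_three_halves {g : ℝ} (hg : 0 ≤ g) : g ^ (3 / 2 : ℝ) = g * Real.sqrt g := by
  rw [show (3 / 2 : ℝ) = 1 + 1 / 2 by norm_num, Real.rpow_add_of_nonneg hg (by norm_num)
    (by norm_num), Real.rpow_one, Real.sqrt_eq_rpow]

/-- With `⌈log T⌉` dyadic levels, the factor `√T` between the `ℓ¹` and `ℓ²` norms of the weights is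
compensated by the finest scale; `log 2 > 1/2` is what is used. -/
theorem sqrt_le_two_pow_ceil_log {T : ℕ} (hT : 2 ≤ T) :
    Real.sqrt T ≤ 2 ^ ⌈Real.log T⌉₊ := by
  have hT' : (0 : ℝ) < T := by exact_mod_cast (by lia : 0 < T)
  have hl := (one_le_log_exp_one_mul_sq hT).2
  have h1 := Nat.le_ceil (Real.log T)
  have h2 := Real.log_two_gt_d9
  rw [Real.sqrt_le_left (by positivity), ← pow_mul, ← Real.log_le_log_iff hT' (by positivity),
    Real.log_pow]
  push_cast
  nlinarith

theorem chaining_const_le {p M : ℝ} (hp : 1 ≤ p) (hM : 1 ≤ M) {T : ℕ} (hT : 2 ≤ T) :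
    2 * (p * M ^ (p - 1) *
      (6 * Real.sqrt (2 * Real.log (2 * T + 1)) * ((⌈Real.log T⌉₊ : ℕ) + 1) + 1))
      ≤ complexityConst p M T := by
  obtain ⟨hg, hl⟩ := one_le_log_exp_one_mul_sq hT
  have hT' : (2 : ℝ) ≤ T := by exact_mod_cast hT
  rw [complexityConst]
  have hℓ : Real.log (2 * T + 1) ≤ Real.log (Real.exp 1 * (T : ℝ) ^ 2) := by
    refine Real.log_le_log (by positivity) ?_
    have := Real.add_one_le_exp (1 : ℝ)
    nlinarith
  set g := Real.log (Real.exp 1 * (T : ℝ) ^ 2) with hgdef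
  have hg1 : 1 ≤ g := by linarith
  rw [rpow_three_halves (by linarith)]
  have hn : ((⌈Real.log T⌉₊ : ℕ) : ℝ) + 1 ≤ 2 * g := by
    have := Nat.ceil_lt_add_one (show 0 ≤ Real.log T by linarith)
    linarith
  have hs : Real.sqrt (2 * Real.log (2 * T + 1)) ≤ Real.sqrt 2 * Real.sqrt g := by
    rw [← Real.sqrt_mul (by norm_num)]
    exact Real.sqrt_le_sqrt (by linarith)
  have hs1 : 1 ≤ Real.sqrt g := Real.one_le_sqrt.2 hg1
  have hs2 : 0 ≤ Real.sqrt 2 := Real.sqrt_nonneg 2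
  have hpi : 1 ≤ Real.sqrt (Real.pi * Real.log T) := by
    refine Real.one_le_sqrt.2 ?_
    nlinarith [Real.pi_gt_three]
  have hMp : M ^ (p - 1) ≤ M ^ p := Real.rpow_le_rpow_of_exponent_le hM (by linarith)
  have hM0 : 0 < M ^ (p - 1) := Real.rpow_pos_of_pos (by linarith) _
  set s := Real.sqrt (2 * Real.log (2 * T + 1)) with hsdef
  have hs0 : 0 ≤ s := Real.sqrt_nonneg _
  have hgs : 0 ≤ g * Real.sqrt g := by positivity
  have h1 : s * ((⌈Real.log T⌉₊ : ℕ) + 1) ≤ Real.sqrt 2 * Real.sqrt g * (2 * g) :=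
    mul_le_mul hs hn (by positivity) (by positivity)
  calc _ ≤ 2 * (p * M ^ p * (6 * (Real.sqrt 2 * Real.sqrt g * (2 * g)) + 1)) := by
        rw [mul_assoc 6]
        gcongr
    _ ≤ 48 * p * M ^ p * 1 * (1 + 4 * Real.sqrt 2 * (g * Real.sqrt g)) := by
        have hpM : 0 ≤ p * M ^ p := mul_nonneg (by linarith) (hM0.le.trans hMp)
        have h2 : 0 ≤ Real.sqrt 2 * (g * Real.sqrt g) := by positivity
        have h3 : 2 * (6 * (Real.sqrt 2 * Real.sqrt g * (2 * g)) + 1)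
            ≤ 48 * (1 + 4 * Real.sqrt 2 * (g * Real.sqrt g)) := by linarith
        have h4 := mul_le_mul_of_nonneg_left h3 hpM
        linarith
    _ ≤ _ := by
        have hpM : 0 ≤ M ^ p := hM0.le.trans hMp
        gcongr

theorem complexityConst_le {p M : ℝ} (hp : 1 ≤ p) (hM : 1 ≤ M) {T : ℕ} (hT : 2 ≤ T) :
    complexityConst p M T ≤ 48 * p * M ^ p * (112 * Real.log T ^ 2) := by
  obtain ⟨hg, hl⟩ := one_le_log_exp_one_mul_sq hT
  rw [complexityConst, hg, rpow_three_halves (by linarith)]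
  set x := Real.log T with hx
  have hx0 : 0 ≤ x := by linarith
  have hpM : 0 ≤ 48 * p * M ^ p :=
    mul_nonneg (by linarith) (Real.rpow_nonneg (by linarith) _)
  rw [mul_assoc]
  refine mul_le_mul_of_nonneg_left ?_ hpM
  have hsx : Real.sqrt x ^ 2 = x := Real.sq_sqrt hx0
  set y := Real.sqrt x with hy
  have hy0 : 0 ≤ y := Real.sqrt_nonneg x
  have h1 : Real.sqrt (Real.pi * x) ≤ 2 * y := by
    rw [Real.sqrt_le_left (by positivity)]
    nlinarith [Real.pi_le_four]
  have h2 : Real.sqrt (1 + 2 * x) ≤ 2 * y := by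
    rw [Real.sqrt_le_left (by positivity)]
    nlinarith
  have h3 : Real.sqrt 2 ≤ 3 / 2 := Real.sqrt_le_iff.2 (by norm_num)
  have hy1 : 1 / 2 ≤ y := by
    rw [hy]
    exact Real.le_sqrt_of_sq_le (by linarith)
  have h4 : 4 * Real.sqrt 2 * ((1 + 2 * x) * Real.sqrt (1 + 2 * x))
      ≤ 6 * ((4 * y ^ 2) * (2 * y)) := by
    have := Real.sqrt_nonneg 2
    gcongr
    · linarith
    · linarith
  have h5 : 1 ≤ 8 * y ^ 3 := by
    have : (1 / 2 : ℝ) ^ 3 ≤ y ^ 3 := by gcongr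
    linarith
  have h6 : 1 + 4 * Real.sqrt 2 * ((1 + 2 * x) * Real.sqrt (1 + 2 * x)) ≤ 56 * y ^ 3 := by
    linarith
  calc _ ≤ 2 * y * (56 * y ^ 3) := by
        have := Real.sqrt_nonneg 2
        have := Real.sqrt_nonneg (1 + 2 * x)
        gcongr
    _ ≤ _ := by
        rw [← hsx]
        exact le_of_eq (by ring)

end Constants

/-! ### Tail bound, passage to the whole ball, and the forecast inequality. -/

section Concentration

/-- Chernoff's bound with the optimal parameter `t = √(2 log (1/δ)) / s`. -/
theorem measure_gt_le_of_lintegral_exp_le {Ω : Type*} [MeasurableSpace Ω] {μ : Measure Ω}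
    {X : Ω → ℝ} (hX : AEMeasurable X μ) {a s δ : ℝ} (hs : 0 < s) (hδ : 0 < δ) (hδ1 : δ ≤ 1)
    (h : ∀ t : ℝ, 0 ≤ t → ∫⁻ ω, ENNReal.ofReal (Real.exp (t * X ω)) ∂μ
      ≤ ENNReal.ofReal (Real.exp (t * a + t ^ 2 * s ^ 2 / 2))) :
    μ {ω | a + s * Real.sqrt (2 * Real.log (1 / δ)) < X ω} ≤ ENNReal.ofReal δ := by
  have hlog : 0 ≤ Real.log (1 / δ) := Real.log_nonneg (by rw [le_div_iff₀ hδ]; linarith)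
  set v := Real.sqrt (2 * Real.log (1 / δ)) with hv
  have hv2 : v ^ 2 = 2 * Real.log (1 / δ) := Real.sq_sqrt (by positivity)
  have hv0 : 0 ≤ v := Real.sqrt_nonneg _
  set t := v / s with ht
  have ht0 : 0 ≤ t := by positivity
  set c := Real.exp (t * (a + s * v)) with hc
  have hc0 : 0 < c := Real.exp_pos _
  have hm : AEMeasurable (fun ω => ENNReal.ofReal (Real.exp (t * X ω))) μ :=
    ENNReal.measurable_ofReal.comp_aemeasurable
      (Real.measurable_exp.comp_aemeasurable (hX.const_mul t))
  have h1 := mul_meas_ge_le_lintegral₀ hm (ENNReal.ofReal c)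
  have hsub : {ω | a + s * v < X ω}
      ⊆ {ω | ENNReal.ofReal c ≤ ENNReal.ofReal (Real.exp (t * X ω))} := fun ω hω =>
    ENNReal.ofReal_le_ofReal (Real.exp_le_exp.2 (mul_le_mul_of_nonneg_left (le_of_lt hω) ht0))
  have e : Real.exp (t * a + t ^ 2 * s ^ 2 / 2) = c * δ := by
    have hδe : δ = Real.exp (-(v ^ 2 / 2)) := by
      rw [hv2, mul_div_cancel_left₀ _ (two_ne_zero' ℝ), one_div, Real.log_inv, neg_neg,
        Real.exp_log hδ]
    rw [hδe, hc, ← Real.exp_add]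
    congr 1
    rw [ht]
    field_simp
    ring
  have h2 : ENNReal.ofReal c * μ {ω | a + s * v < X ω} ≤ ENNReal.ofReal c * ENNReal.ofReal δ := by
    rw [← ENNReal.ofReal_mul hc0.le, ← e]
    exact (mul_le_mul_right (measure_mono hsub) _).trans (h1.trans (h t ht0))
  exact (ENNReal.mul_le_mul_iff_right (by simpa using hc0) ENNReal.ofReal_ne_top).1 h2

theorem exists_gt_of_mem_closure_range {X : Type*} [TopologicalSpace X] {u : ℕ → X} {s : Set X}
    (hu : ∀ n, u n ∈ s) {w : X}
    (hw : w ∈ closure (Set.range u)) (hws : w ∈ s) {F : X → ℝ} (hF : ContinuousOn F s) {c : ℝ}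
    (hc : c < F w) : ∃ n, c < F (u n) := by
  have h1 : Tendsto F (nhdsWithin w (Set.range u)) (nhds (F w)) :=
    (hF w hws).mono (Set.range_subset_iff.2 hu)
  have : (nhdsWithin w (Set.range u)).NeBot := mem_closure_iff_nhdsWithin_neBot.1 hw
  obtain ⟨_, h2, n, rfl⟩ := ((h1.eventually (lt_mem_nhds hc)).and self_mem_nhdsWithin).exists
  exact ⟨n, h2⟩

/-- The residual bound at `w = 0` and at the multiple of `Ψ x` of norm `Λ` forces `‖Ψ x‖ ≤ 2M / Λ`.
Thus the supremum defining the radius is over a bounded set and is not the default value. -/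
theorem norm_le_kernelRadius {𝒳 ℋ : Type*} [NormedAddCommGroup ℋ] [InnerProductSpace ℝ ℋ]
    {𝒴 : Set ℝ} {Ψ : 𝒳 → ℋ} {Λ M : ℝ} (hΛ : 0 < Λ) (y : 𝒴)
    (hres : ∀ w : ℋ, ‖w‖ ≤ Λ → ∀ x (y : 𝒴), |⟪w, Ψ x⟫_ℝ - (y : ℝ)| ≤ M) (x : 𝒳) :
    ‖Ψ x‖ ≤ kernelRadius Ψ := by
  have hM : 0 ≤ M := (abs_nonneg _).trans (hres 0 (by simpa using hΛ.le) x y)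
  have hbd : ∀ x, ‖Ψ x‖ ≤ 2 * M / Λ := fun x => by
    rw [le_div_iff₀ hΛ]
    by_cases h0 : Ψ x = 0
    · simpa [h0] using hM
    have hn : 0 < ‖Ψ x‖ := norm_pos_iff.2 h0
    have h1 := abs_le.1 (hres ((Λ / ‖Ψ x‖) • Ψ x)
      (by rw [norm_smul, Real.norm_of_nonneg (by positivity), div_mul_cancel₀ _ hn.ne']) x y)
    have h2 := abs_le.1 (hres 0 (by simpa using hΛ.le) x y)
    have h3 : ⟪(Λ / ‖Ψ x‖) • Ψ x, Ψ x⟫_ℝ = ‖Ψ x‖ * Λ := by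
      rw [real_inner_smul_left, real_inner_self_eq_norm_sq]
      field_simp
    rw [h3] at h1
    rw [inner_zero_left] at h2
    linarith
  refine Real.le_sqrt_of_sq_le ?_
  have hb : BddAbove (Set.range fun x => kernelOf Ψ x x) := by
    refine ⟨(2 * M / Λ) ^ 2, ?_⟩
    rintro _ ⟨x, rfl⟩
    simp only [kernelOf, real_inner_self_eq_norm_sq]
    exact pow_le_pow_left₀ (norm_nonneg _) (hbd x) 2
  have := le_ciSup hb x
  simpa only [kernelOf, real_inner_self_eq_norm_sq] using this

variable {Ω 𝒵 : Type*} [MeasurableSpace Ω] [MeasurableSpace 𝒵]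
  {κ : (t : ℕ) → Kernel (Fin t → 𝒵) 𝒵}

theorem aemeasurable_deviation {μ : Measure Ω} [∀ t, IsMarkovKernel (κ t)] {Z : ℕ → Ω → 𝒵} {T : ℕ}
    (hZ : ∀ n < T, HasCondDistrib (Z n) (fun ω (i : Fin n) => Z i ω) (κ n) μ) (q : ℕ → ℝ)
    {g : 𝒵 → ℝ} (hg : Measurable g) :
    AEMeasurable (fun ω => deviation κ q g T fun k => Z k ω) μ := by
  refine Finset.aemeasurable_fun_sum _ fun k hk => ?_
  have hk' := hZ k (Finset.mem_range.1 hk)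
  exact (((measurable_condMean_past hg k).comp_aemeasurable hk'.aemeasurable_fst).sub
    (hg.comp_aemeasurable hk'.aemeasurable_snd)).const_mul _

variable {𝒳 ℋ : Type*} [MeasurableSpace 𝒳] [NormedAddCommGroup ℋ] [InnerProductSpace ℝ ℋ]
  {𝒴 : Set ℝ} {Ψ : 𝒳 → ℋ}

theorem measurable_powerLoss (hΨ : StronglyMeasurable Ψ) (p : ℝ) (w : ℋ) :
    Measurable fun z : 𝒳 × 𝒴 => powerLoss p (fun x => ⟪w, Ψ x⟫_ℝ) z := by
  have h1 : Measurable fun x => ⟪w, Ψ x⟫_ℝ :=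
    (StronglyMeasurable.inner stronglyMeasurable_const hΨ).measurable
  have h2 : Measurable fun z : 𝒳 × 𝒴 => |⟪w, Ψ z.1⟫_ℝ - (z.2 : ℝ)| :=
    ((h1.comp measurable_fst).sub (measurable_subtype_coe.comp measurable_snd)).abs
  exact h2.pow_const p

theorem continuousOn_condMean (hΨ : StronglyMeasurable Ψ) {p B Λ : ℝ} (hp : 0 ≤ p)
    {κ : (t : ℕ) → Kernel (Fin t → 𝒳 × 𝒴) (𝒳 × 𝒴)} [∀ t, IsMarkovKernel (κ t)]
    (hloss : ∀ w : ℋ, ‖w‖ ≤ Λ → ∀ z : 𝒳 × 𝒴, |powerLoss p (fun x => ⟪w, Ψ x⟫_ℝ) z| ≤ B)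
    (t : ℕ) (ζ : ℕ → 𝒳 × 𝒴) :
    ContinuousOn (fun w : ℋ => condMean κ (powerLoss p fun x => ⟪w, Ψ x⟫_ℝ) t ζ)
      (Metric.closedBall 0 Λ) := by
  refine continuousOn_of_dominated (bound := fun _ => B)
    (fun w _ => (measurable_powerLoss hΨ p w).aestronglyMeasurable)
    (fun w hw => ae_of_all _ fun z => hloss w (by simpa using hw) z) (integrable_const _)
    (ae_of_all _ fun z => Continuous.continuousOn ?_)
  unfold powerLoss
  exact Continuous.rpow_const (by fun_prop) fun _ => Or.inr hp

theorem continuousOn_deviation (hΨ : StronglyMeasurable Ψ) {p B Λ : ℝ} (hp : 0 ≤ p)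
    {κ : (t : ℕ) → Kernel (Fin t → 𝒳 × 𝒴) (𝒳 × 𝒴)} [∀ t, IsMarkovKernel (κ t)]
    (hloss : ∀ w : ℋ, ‖w‖ ≤ Λ → ∀ z : 𝒳 × 𝒴, |powerLoss p (fun x => ⟪w, Ψ x⟫_ℝ) z| ≤ B)
    (q : ℕ → ℝ) (T : ℕ) (ζ : ℕ → 𝒳 × 𝒴) :
    ContinuousOn (fun w : ℋ => deviation κ q (powerLoss p fun x => ⟪w, Ψ x⟫_ℝ) T ζ)
      (Metric.closedBall 0 Λ) := by
  refine continuousOn_finsetSum _ fun k _ => continuousOn_const.mul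
    ((continuousOn_condMean hΨ hp hloss k ζ).sub (Continuous.continuousOn ?_))
  unfold powerLoss
  exact Continuous.rpow_const (by fun_prop) fun _ => Or.inr hp

/-- The functionals given by a ball are represented by a separable part of the ball. -/
theorem exists_dense_weights [CompleteSpace ℋ] (hΨ : StronglyMeasurable Ψ) {Λ : ℝ} (hΛ : 0 ≤ Λ) :
    ∃ u : ℕ → ℋ, (∀ n, ‖u n‖ ≤ Λ) ∧ ∀ w : ℋ, ‖w‖ ≤ Λ →
      ∃ w' ∈ closure (Set.range u), ‖w'‖ ≤ Λ ∧ ∀ x, ⟪w', Ψ x⟫_ℝ = ⟪w, Ψ x⟫_ℝ := by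
  set V := (Submodule.span ℝ (Set.range Ψ)).topologicalClosure with hV
  have hsep : TopologicalSpace.IsSeparable ((V : Set ℋ) ∩ Metric.closedBall 0 Λ) := by
    refine TopologicalSpace.IsSeparable.mono ?_ Set.inter_subset_left
    rw [hV, Submodule.topologicalClosure_coe]
    exact hΨ.isSeparable_range.span.closure
  obtain ⟨D, hD, hDc, hDd⟩ := hsep.exists_countable_dense_subset
  have h0 : (0 : ℋ) ∈ closure D := hDd ⟨V.zero_mem, by simpa using hΛ⟩
  obtain ⟨u, rfl⟩ := hDc.exists_eq_range (closure_nonempty_iff.1 ⟨0, h0⟩)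
  have : CompleteSpace V := (Submodule.isClosed_topologicalClosure _).completeSpace_coe
  refine ⟨u, fun n => by simpa using (hD ⟨n, rfl⟩).2, fun w hw => ?_⟩
  -- Projecting onto the closed span of the features does not increase the norm and leaves all
  -- predictions unchanged; this span is separable because `Ψ` is strongly measurable.
  have hn : ‖V.starProjection w‖ ≤ Λ := (V.norm_starProjection_apply_le w).trans hw
  refine ⟨V.starProjection w, hDd ⟨V.starProjection_apply_mem w, by simpa using hn⟩, hn,
    fun x => ?_⟩
  have hx : Ψ x ∈ V := Submodule.le_topologicalClosure _ (Submodule.subset_span ⟨x, rfl⟩)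
  have := V.starProjection_inner_eq_zero w (Ψ x) hx
  rw [inner_sub_left] at this
  linarith

/-- Uniform concentration of the losses of a ball of linear functionals around their conditional
means. -/
theorem measure_exists_deviation_gt_le [CompleteSpace ℋ] (hΨ : StronglyMeasurable Ψ)
    {p M B Λ r ν δ : ℝ} (hp : 1 ≤ p) (hM : 1 ≤ M) (hB : 0 < B) (hν : 0 < ν) (hΛ : 0 ≤ Λ)
    (hr : 0 ≤ r) (hΨr : 0 < Λ → ∀ x, ‖Ψ x‖ ≤ r) (hδ : 0 < δ) (hδ1 : δ ≤ 1)
    (hres : ∀ w : ℋ, ‖w‖ ≤ Λ → ∀ x (y : 𝒴), |⟪w, Ψ x⟫_ℝ - (y : ℝ)| ≤ M)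
    (hloss : ∀ w : ℋ, ‖w‖ ≤ Λ → ∀ z : 𝒳 × 𝒴, |powerLoss p (fun x => ⟪w, Ψ x⟫_ℝ) z| ≤ B)
    {μ : Measure Ω} [IsProbabilityMeasure μ] {T : ℕ} (hT : 2 ≤ T) {Z : ℕ → Ω → 𝒳 × 𝒴}
    {κ : (t : ℕ) → Kernel (Fin t → 𝒳 × 𝒴) (𝒳 × 𝒴)} [∀ t, IsMarkovKernel (κ t)]
    (hZ : ∀ t < T, HasCondDistrib (Z t) (fun ω (i : Fin t) => Z i ω) (κ t) μ)
    {q : ℕ → ℝ} (hq : ∑ k : Fin T, q k ^ 2 = ν ^ 2) :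
    μ {ω | ∃ w : ℋ, ‖w‖ ≤ Λ ∧ complexityConst p M T * Λ * r * ν
        + 2 * B * ν * Real.sqrt (2 * Real.log (1 / δ))
        < deviation κ q (powerLoss p fun x => ⟪w, Ψ x⟫_ℝ) T fun k => Z k ω}
      ≤ ENNReal.ofReal δ := by
  have : Nonempty Ω := nonempty_of_isProbabilityMeasure μ
  have : Nonempty (𝒳 × 𝒴) := ⟨Z 0 (Classical.arbitrary Ω)⟩
  obtain ⟨u, hu, hdense⟩ := exists_dense_weights hΨ hΛ
  set ql := List.ofFn fun k : Fin T => q k with hql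
  have hlen : ql.length = T := by simp [hql]
  have hsq : (ql.map (· ^ 2)).sum = ν ^ 2 := by
    rw [hql, List.map_ofFn, List.sum_ofFn, ← hq]
    rfl
  have habs : (ql.map abs).sum ≤ 2 ^ ⌈Real.log T⌉₊ * ν := by
    have h1 : (ql.map abs).sum = ∑ k : Fin T, |q k| := by
      rw [hql, List.map_ofFn, List.sum_ofFn]
      rfl
    -- Cauchy–Schwarz compares the two norms of the weights.
    have h2 : (∑ k : Fin T, |q k|) ^ 2 ≤ T * ν ^ 2 := by
      have := sq_sum_le_card_mul_sum_sq (s := (Finset.univ : Finset (Fin T))) (f := fun k => |q k|)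
      simpa [sq_abs, hq] using this
    have h3 : (∑ k : Fin T, |q k|) ≤ Real.sqrt T * ν := by
      refine le_of_sq_le_sq ?_ (by positivity)
      rwa [mul_pow, Real.sq_sqrt (Nat.cast_nonneg _)]
    rw [h1]
    exact h3.trans (mul_le_mul_of_nonneg_right (sqrt_le_two_pow_ceil_log hT) hν.le)
  set m := p * M ^ (p - 1) * (Λ * r) * ν *
    (6 * Real.sqrt (2 * Real.log (2 * T + 1)) * ((⌈Real.log T⌉₊ : ℕ) + 1) + 1) with hm
  have hmC : 2 * m ≤ complexityConst p M T * Λ * r * ν := by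
    have h1 : 0 ≤ Λ * r * ν := by positivity
    calc 2 * m = 2 * (p * M ^ (p - 1) *
          (6 * Real.sqrt (2 * Real.log (2 * T + 1)) * ((⌈Real.log T⌉₊ : ℕ) + 1) + 1))
            * (Λ * r * ν) := by rw [hm]; ring
      _ ≤ complexityConst p M T * (Λ * r * ν) :=
          mul_le_mul_of_nonneg_right (chaining_const_le hp hM hT) h1
      _ = _ := by ring
  set c := complexityConst p M T * Λ * r * ν
    + 2 * B * ν * Real.sqrt (2 * Real.log (1 / δ)) with hc
  set Φ : ℋ → Ω → ℝ := fun w ω =>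
    deviation κ q (powerLoss p fun x => ⟪w, Ψ x⟫_ℝ) T fun k => Z k ω with hΦ
  have hfin : ∀ N : ℕ, μ {ω | ∃ i : Fin (N + 1), c < Φ (u i) ω} ≤ ENNReal.ofReal δ := by
    intro N
    have hX : AEMeasurable (fun ω => ⨆ i : Fin (N + 1), Φ (u i) ω) μ :=
      AEMeasurable.iSup fun i => aemeasurable_deviation hZ q (measurable_powerLoss hΨ p _)
    have h := measure_gt_le_of_lintegral_exp_le hX (a := 2 * m) (s := 2 * (B * ν))
      (by positivity) hδ hδ1 fun t ht => by
        refine (lintegral_exp_deviation_le (ι := Fin (N + 1))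
          (f := fun i => powerLoss p fun x => ⟪u i, Ψ x⟫_ℝ) (B := B) ht
          (fun i => hloss _ (hu _)) (fun i => measurable_powerLoss hΨ p _) hZ q).trans ?_
        refine ENNReal.ofReal_le_ofReal ?_
        have hV := treeValue_powerLoss_le (𝒴 := 𝒴) (Ψ := Ψ) (w := fun i : Fin (N + 1) => u i)
          (q := ql) ht hp hM hB hν hΛ hr (fun i => hu _) hΨr (fun i => hres _ (hu _))
          (fun i => hloss _ (hu _)) hsq habs
        rwa [hlen] at hV
    refine (measure_mono ?_).trans h
    rintro ω ⟨i, hi⟩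
    have h1 : Φ (u i) ω ≤ ⨆ i : Fin (N + 1), Φ (u i) ω :=
      le_ciSup (f := fun i : Fin (N + 1) => Φ (u i) ω) (Set.finite_range _).bddAbove i
    rw [Set.mem_ofPred_eq]
    rw [hc] at hi
    linarith
  have hmono : Monotone fun N : ℕ => {ω | ∃ i : Fin (N + 1), c < Φ (u i) ω} := by
    rintro N N' hNN ω ⟨i, hi⟩
    exact ⟨⟨i, by lia⟩, hi⟩
  -- The bound for finite families does not depend on their size. A strict violation by any `w`
  -- persists, by continuity, at some `u n`, so continuity from below along this increasing union is
  -- enough.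
  refine (measure_mono (t := ⋃ N : ℕ, {ω | ∃ i : Fin (N + 1), c < Φ (u i) ω}) ?_).trans ?_
  · rintro ω ⟨w, hw, hlt⟩
    obtain ⟨w', hw', hn', heq⟩ := hdense w hw
    have hlt' : c < Φ w' ω := by
      simp only [hΦ, heq]
      exact hlt
    obtain ⟨n, hn⟩ := exists_gt_of_mem_closure_range (s := Metric.closedBall 0 Λ)
      (fun n => by simpa using hu n) hw' (by simpa using hn') (F := fun w => Φ w ω)
      (continuousOn_deviation hΨ (by linarith) hloss q T _) hlt'
    exact Set.mem_iUnion.2 ⟨n, ⟨n, by lia⟩, hn⟩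
  · rw [hmono.measure_iUnion]
    exact iSup_le hfin

theorem abs_condMean_le {𝒵 : Type*} [MeasurableSpace 𝒵] {κ : (t : ℕ) → Kernel (Fin t → 𝒵) 𝒵}
    [∀ t, IsMarkovKernel (κ t)] {g : 𝒵 → ℝ} {B : ℝ} (hg : ∀ z, |g z| ≤ B) (t : ℕ) (ζ : ℕ → 𝒵) :
    |condMean κ g t ζ| ≤ B := by
  simpa [condMean] using norm_integral_le_of_norm_le_const (μ := κ t fun i : Fin t => ζ i) (f := g) (C := B)
    (ae_of_all _ hg)

theorem condMean_sub_le_disc {𝒵 : Type*} [MeasurableSpace 𝒵]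
    {κ : (t : ℕ) → Kernel (Fin t → 𝒵) 𝒵} [∀ t, IsMarkovKernel (κ t)] {F : Set (𝒵 → ℝ)} {B : ℝ}
    (hF : ∀ g ∈ F, ∀ z, |g z| ≤ B) {T : ℕ} (q : EuclideanSpace ℝ (Fin T)) (ζ : ℕ → 𝒵)
    {g : 𝒵 → ℝ} (hg : g ∈ F) :
    condMean κ g T ζ - ∑ t : Fin T, q t * condMean κ g t ζ ≤ disc κ F q ζ := by
  refine le_ciSup (f := fun f : F => condMean κ f T ζ - ∑ t : Fin T, q t * condMean κ f t ζ)
    ⟨B + ∑ t : Fin T, |q t| * B, ?_⟩ ⟨g, hg⟩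
  rintro _ ⟨f, rfl⟩
  have h1 := abs_le.1 (abs_condMean_le (κ := κ) (hF f f.2) T ζ)
  have h2 : |∑ t : Fin T, q t * condMean κ f t ζ| ≤ ∑ t : Fin T, |q t| * B := by
    refine (Finset.abs_sum_le_sum_abs _ _).trans (Finset.sum_le_sum fun t _ => ?_)
    rw [abs_mul]
    exact mul_le_mul_of_nonneg_left (abs_condMean_le (hF f f.2) t ζ) (abs_nonneg _)
  have h3 := abs_le.1 h2
  change condMean κ f T ζ - ∑ t : Fin T, q t * condMean κ f t ζ ≤ _
  linarith

/-- The high-probability bound for all hypotheses simultaneously. -/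
theorem exists_event_forecast_bound [CompleteSpace ℋ] {μ : Measure Ω} [IsProbabilityMeasure μ]
    (hΨ : StronglyMeasurable Ψ) {Λ p M B : ℝ} (hΛ : 0 ≤ Λ) (hp : 1 ≤ p) (hM : 1 ≤ M)
    (hres : ∀ h ∈ kernelHypotheses Ψ Λ, ∀ (x : 𝒳) (y : 𝒴), |h x - (y : ℝ)| ≤ M)
    (hloss : ∀ f ∈ lossClass 𝒴 p (kernelHypotheses Ψ Λ), ∀ z, |f z| ≤ B) {T : ℕ} (hT : 2 ≤ T)
    {Z : ℕ → Ω → 𝒳 × 𝒴} {κ : (t : ℕ) → Kernel (Fin t → 𝒳 × 𝒴) (𝒳 × 𝒴)}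
    [∀ t, IsMarkovKernel (κ t)]
    (hZ : ∀ t ≤ T, HasCondDistrib (Z t) (fun ω (i : Fin t) => Z i ω) (κ t) μ)
    (q : EuclideanSpace ℝ (Fin T)) {δ : ℝ} (hδ : 0 < δ) :
    ∃ E : Set Ω, MeasurableSet E ∧ ENNReal.ofReal (1 - δ) ≤ μ E ∧
      ∀ ω ∈ E, ∀ h ∈ kernelHypotheses Ψ Λ,
        condMean κ (powerLoss p h) T (fun t => Z t ω)
          ≤ ∑ t : Fin T, q t * powerLoss p h (Z t ω)
            + disc κ (lossClass 𝒴 p (kernelHypotheses Ψ Λ)) q (fun t => Z t ω)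
            + complexityConst p M T * Λ * kernelRadius Ψ * ‖q‖
            + 2 * B * ‖q‖ * Real.sqrt (2 * Real.log (1 / δ)) := by
  have : Nonempty Ω := nonempty_of_isProbabilityMeasure μ
  obtain ⟨x₀, y₀⟩ := Z 0 (Classical.arbitrary Ω)
  rcases lt_or_ge 1 δ with hδ1 | hδ1
  · exact ⟨∅, MeasurableSet.empty, by simp [hδ1.le], by simp⟩
  have hres' : ∀ w : ℋ, ‖w‖ ≤ Λ → ∀ x (y : 𝒴), |⟪w, Ψ x⟫_ℝ - (y : ℝ)| ≤ M :=
    fun w hw => hres _ ⟨w, hw, rfl⟩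
  have hloss' : ∀ w : ℋ, ‖w‖ ≤ Λ → ∀ z : 𝒳 × 𝒴, |powerLoss p (fun x => ⟪w, Ψ x⟫_ℝ) z| ≤ B :=
    fun w hw => hloss _ ⟨_, ⟨w, hw, rfl⟩, rfl⟩
  have hB : 0 ≤ B := (abs_nonneg _).trans (hloss' 0 (by simpa using hΛ) (x₀, y₀))
  set q' : ℕ → ℝ := fun k => if h : k < T then q ⟨k, h⟩ else 0 with hq'
  have hqq : ∀ k : Fin T, q' k = q k := fun k => by simp [hq']
  have hnorm : ∑ k : Fin T, q' k ^ 2 = ‖q‖ ^ 2 := by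
    simp [EuclideanSpace.norm_sq_eq, hqq]
  have hr : 0 ≤ kernelRadius Ψ := Real.sqrt_nonneg _
  set c := complexityConst p M T * Λ * kernelRadius Ψ * ‖q‖
    + 2 * B * ‖q‖ * Real.sqrt (2 * Real.log (1 / δ)) with hc
  set bad := {ω | ∃ w : ℋ, ‖w‖ ≤ Λ ∧
    c < deviation κ q' (powerLoss p fun x => ⟪w, Ψ x⟫_ℝ) T fun k => Z k ω} with hbad
  have hbadδ : μ bad ≤ ENNReal.ofReal δ := by
    -- The subgaussian estimates need positive scales. For `B = 0` all losses vanish and for `q = 0`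
    -- all deviations do, so the bad event is empty.
    rcases hB.eq_or_lt with hB0 | hB0
    · have : bad = ∅ := by
        refine Set.eq_empty_of_forall_notMem ?_
        rintro ω ⟨w, hw, hlt⟩
        have hz : (powerLoss p fun x => ⟪w, Ψ x⟫_ℝ : 𝒳 × 𝒴 → ℝ) = fun _ => 0 := by
          funext z
          exact abs_nonpos_iff.1 (hB0 ▸ hloss' w hw z)
        have hC : 0 ≤ complexityConst p M T := by
          refine le_trans ?_ (chaining_const_le hp hM hT)
          have := Real.rpow_nonneg (show 0 ≤ M by linarith) (p - 1)
          positivity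
        rw [hz] at hlt
        have h0 : deviation κ q' (fun _ => 0) T (fun k => Z k ω) = 0 := by
          simp [deviation, condMean]
        rw [h0, hc] at hlt
        have : 0 ≤ complexityConst p M T * Λ * kernelRadius Ψ * ‖q‖
          + 2 * B * ‖q‖ * Real.sqrt (2 * Real.log (1 / δ)) := by positivity
        linarith
      simp [this]
    rcases (norm_nonneg q).eq_or_lt with hq0 | hq0
    · have : bad = ∅ := by
        refine Set.eq_empty_of_forall_notMem ?_
        rintro ω ⟨w, hw, hlt⟩
        have h0 : ∀ k, q' k = 0 := fun k => by
          have : q = 0 := norm_eq_zero.1 hq0.symm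
          simp [hq', this]
        rw [hc, ← hq0] at hlt
        simp [deviation, h0] at hlt
      simp [this]
    exact measure_exists_deviation_gt_le hΨ hp hM hB0 hq0 hΛ hr
      (fun h => norm_le_kernelRadius h y₀ hres') hδ hδ1 hres' hloss' hT
      (fun t ht => hZ t ht.le) hnorm
  -- The bad event is an uncountable union, possibly not measurable; its outer measure was bounded,
  -- and a measurable hull has the same measure.
  refine ⟨(toMeasurable μ bad)ᶜ, (measurableSet_toMeasurable _ _).compl, ?_, ?_⟩
  · rw [prob_compl_eq_one_sub (measurableSet_toMeasurable _ _), measure_toMeasurable,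
      ENNReal.ofReal_sub _ hδ.le, ENNReal.ofReal_one]
    exact tsub_le_tsub_left hbadδ _
  · rintro ω hω h ⟨w, hw, rfl⟩
    have hdev : deviation κ q' (powerLoss p fun x => ⟪w, Ψ x⟫_ℝ) T (fun k => Z k ω) ≤ c := by
      by_contra! hlt
      exact hω (subset_toMeasurable μ bad ⟨w, hw, hlt⟩)
    have hdisc := condMean_sub_le_disc (κ := κ) hloss q (fun t => Z t ω)
      (g := powerLoss p fun x => ⟪w, Ψ x⟫_ℝ) ⟨_, ⟨w, hw, rfl⟩, rfl⟩
    rw [deviation, Finset.sum_range] at hdev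
    simp only [hqq, mul_sub, Finset.sum_sub_distrib] at hdev
    rw [hc] at hdev
    linarith

end Concentration

end Forecast

theorem theorem5 :
    -- `A` is an absolute constant
    ∃ A : ℝ, 0 < A ∧
    -- the constant `C_T` is `O(log² T)` for fixed `p` and `M`
    (∀ p M : ℝ, 1 ≤ p → 1 ≤ M →
      (fun T : ℕ => Forecast.complexityConst p M T) =O[atTop]
        fun T : ℕ => Real.log (T : ℝ) ^ 2) ∧
    ∀ (Ω 𝒳 ℋ : Type*) [MeasurableSpace Ω] [MeasurableSpace 𝒳]
      [NormedAddCommGroup ℋ] [InnerProductSpace ℝ ℋ] [CompleteSpace ℋ]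
      (μ : Measure Ω) [IsProbabilityMeasure μ]
      -- outputs, feature map, hypothesis radius, exponent
      (𝒴 : Set ℝ) (Ψ : 𝒳 → ℋ) (_ : StronglyMeasurable Ψ) (Λ : ℝ) (_ : 0 ≤ Λ)
      (p : ℝ) (_ : 1 ≤ p)
      -- `M` bounds the residuals, `B` bounds the losses
      (M : ℝ) (_ : 1 ≤ M)
      (_ : ∀ h ∈ Forecast.kernelHypotheses Ψ Λ, ∀ (x : 𝒳) (y : 𝒴), |h x - (y : ℝ)| ≤ M)
      (B : ℝ) (_ : ∀ f ∈ Forecast.lossClass 𝒴 p (Forecast.kernelHypotheses Ψ Λ), ∀ z, |f z| ≤ B)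
      -- the process (`Z t` is the observation number `t + 1`), its conditional distributions
      (T : ℕ) (_ : 2 ≤ T) (Z : ℕ → Ω → 𝒳 × 𝒴)
      (κ : (t : ℕ) → Kernel (Fin t → 𝒳 × 𝒴) (𝒳 × 𝒴)) (_ : ∀ t, IsMarkovKernel (κ t))
      (_ : ∀ t ≤ T, HasCondDistrib (Z t) (fun ω (i : Fin t) => Z i ω) (κ t) μ)
      -- weights and confidence level
      (q : EuclideanSpace ℝ (Fin T)) (δ : ℝ) (_ : 0 < δ),
      -- the bound with the explicit constant
      (∃ E : Set Ω, MeasurableSet E ∧ ENNReal.ofReal (1 - δ) ≤ μ E ∧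
        ∀ ω ∈ E, ∀ h ∈ Forecast.kernelHypotheses Ψ Λ,
          Forecast.condMean κ (Forecast.powerLoss p h) T (fun t => Z t ω)
            ≤ ∑ t : Fin T, q t * Forecast.powerLoss p h (Z t ω)
              + Forecast.disc κ (Forecast.lossClass 𝒴 p (Forecast.kernelHypotheses Ψ Λ)) q
                  (fun t => Z t ω)
              + Forecast.complexityConst p M T * Λ * Forecast.kernelRadius Ψ * ‖q‖
              + 2 * B * ‖q‖ * Real.sqrt (2 * Real.log (1 / δ))) ∧
      -- the bound for the squared loss
      (p = 2 →
        ∃ E : Set Ω, MeasurableSet E ∧ ENNReal.ofReal (1 - δ) ≤ μ E ∧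
          ∀ ω ∈ E, ∀ h ∈ Forecast.kernelHypotheses Ψ Λ,
            Forecast.condMean κ (fun z => (h z.1 - (z.2 : ℝ)) ^ 2) T (fun t => Z t ω)
              ≤ ∑ t : Fin T, q t * (h (Z t ω).1 - ((Z t ω).2 : ℝ)) ^ 2
                + Forecast.disc κ (Forecast.lossClass 𝒴 2 (Forecast.kernelHypotheses Ψ Λ)) q
                    (fun t => Z t ω)
                + A * M ^ 2 * Real.log (T : ℝ) ^ 2 * Λ * Forecast.kernelRadius Ψ * ‖q‖
                + 2 * B * ‖q‖ * Real.sqrt (2 * Real.log (1 / δ))) := by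
  -- The constant is the factor of `M ^ p * log² T` in `complexityConst_le` at `p = 2`.
  refine ⟨48 * 2 * 112, by norm_num, fun p M hp hM => ?_, ?_⟩
  · refine IsBigO.of_bound (48 * p * M ^ p * 112) ?_
    filter_upwards [eventually_ge_atTop 2] with T hT
    have hpM : 0 ≤ M ^ p := Real.rpow_nonneg (by linarith) p
    have h0 : 0 ≤ Forecast.complexityConst p M T := by
      refine le_trans ?_ (Forecast.chaining_const_le hp hM hT)
      have := Real.rpow_nonneg (show 0 ≤ M by linarith) (p - 1)
      positivity
    rw [Real.norm_of_nonneg h0, Real.norm_of_nonneg (sq_nonneg _), mul_assoc]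
    exact Forecast.complexityConst_le hp hM hT
  intro Ω 𝒳 ℋ _ _ _ _ _ μ _ 𝒴 Ψ hΨ Λ hΛ p hp M hM hres B hloss T hT Z κ _ hZ q δ hδ
  obtain ⟨E, hE, hμE, hbound⟩ :=
    Forecast.exists_event_forecast_bound hΨ hΛ hp hM hres hloss hT hZ q hδ
  refine ⟨⟨E, hE, hμE, hbound⟩, ?_⟩
  rintro rfl
  refine ⟨E, hE, hμE, fun ω hω h hh => ?_⟩
  have hsq : ∀ z : 𝒳 × 𝒴, Forecast.powerLoss 2 h z = (h z.1 - (z.2 : ℝ)) ^ 2 := fun z => by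
    rw [Forecast.powerLoss, Real.rpow_two, sq_abs]
  have hb := hbound ω hω h hh
  rw [show Forecast.powerLoss (𝒴 := 𝒴) 2 h = fun z => (h z.1 - (z.2 : ℝ)) ^ 2 from funext hsq] at hb
  have hC := Forecast.complexityConst_le hp hM hT
  rw [Real.rpow_two] at hC
  have hr : 0 ≤ Λ * Forecast.kernelRadius Ψ * ‖q‖ :=
    mul_nonneg (mul_nonneg hΛ (Real.sqrt_nonneg _)) (norm_nonneg _)
  have := mul_le_mul_of_nonneg_right hC hr
  linarith
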